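/- Let $G$ be a locally compact (Hausdorff) group with left Haar measure $\mu$, and let $\omega\colon G\to(0,\infty)$ be a weight, that is, a continuous function with $\omega(gh)\le\omega(g)\,\omega(h)$ for all $g,h\in G$. Let $L^1(G,\omega)$ be the Beurling algebra of all (classes of) measurable functions $f\colon G\to\mathbb C$ with $\|f\|_\omega=\int_G |f|\,\omega\,d\mu<\infty$, under the convolution product $(f*g)(x)=\int_G f(y)\,g(y^{-1}x)\,d\mu(y)$. A Banach algebra $A$ is called pseudo-amenable if there is a (not necessarily bounded) net $(m_i)$ in the projective tensor product $A\hat\otimes A$ such that $a\cdot m_i-m_i\cdot a\to 0$ and $a\,\pi(m_i)\to a$ in norm for every $a\in A$, where $a\cdot(b\otimes c)=ab\otimes c$, $(b\otimes c)\cdot a=b\otimes ca$ and $\pi(b\otimes c)=bc$. If $L^1(G,\omega)$ is pseudo-amenable, then there is a continuous positive character on $G$ dominated by $\omega$, that is, a continuous group homomorphism $\varphi\colon G\to(0,\infty)$ (into the multiplicative group of positive reals) such that $\varphi(g)\le\omega(g)$ for all $g\in G$. -/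

import Mathlib

set_option linter.unusedSectionVars false

open MeasureTheory Filter Topology
open scoped ENNReal TensorProduct

/-! ### Pseudo-amenability of Banach algebras

A (complex, not necessarily unital) Banach algebra `A` is given by the instances
`[NonUnitalNormedRing A] [NormedSpace ℂ A] [IsScalarTower ℂ A A] [SMulCommClass ℂ A A]
[CompleteSpace A]`. -/

section PseudoAmenable

universe u

variable (A : Type u) [NonUnitalNormedRing A] [NormedSpace ℂ A] [IsScalarTower ℂ A A]
  [SMulCommClass ℂ A A]

/-- The projective tensor product `A ⊗^ A`: the completion of the algebraic tensor product
`A ⊗ A` over `ℂ` for the projective norm. -/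
abbrev ProjTensor : Type u := UniformSpace.Completion (⨂[ℂ] _ : Fin 2, A)

variable {A}

/-- The left module action `a · (b ⊗ c) = (a b) ⊗ c` on `A ⊗^ A`. -/
noncomputable def ProjTensor.leftAct (a : A) : ProjTensor A →L[ℂ] ProjTensor A :=
  (PiTensorProduct.mapL (𝕜 := ℂ) (E := fun _ : Fin 2 => A) (E' := fun _ : Fin 2 => A)
    ![ContinuousLinearMap.mul ℂ A a, ContinuousLinearMap.id ℂ A]).completion

/-- The right module action `(b ⊗ c) · a = b ⊗ (c a)` on `A ⊗^ A`. -/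
noncomputable def ProjTensor.rightAct (a : A) : ProjTensor A →L[ℂ] ProjTensor A :=
  (PiTensorProduct.mapL (𝕜 := ℂ) (E := fun _ : Fin 2 => A) (E' := fun _ : Fin 2 => A)
    ![ContinuousLinearMap.id ℂ A, (ContinuousLinearMap.mul ℂ A).flip a]).completion

variable (A) in
/-- The multiplication of `A` as a bounded bilinear map. -/
noncomputable def mulBilin : ContinuousMultilinearMap ℂ (fun _ : Fin 2 => A) A :=
  MultilinearMap.mkContinuous
    { toFun := fun m => m 0 * m 1
      map_update_add' := by
        intro _ m i x y
        fin_cases i <;> simp [add_mul, mul_add]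
      map_update_smul' := by
        intro _ m i c x
        fin_cases i <;> simp [smul_mul_assoc, mul_smul_comm] }
    1 (fun m => by simpa [Fin.prod_univ_two] using norm_mul_le (m 0) (m 1))

variable (A) in
/-- The product map `π : A ⊗^ A → A`, `π (b ⊗ c) = b c`. -/
noncomputable def ProjTensor.prodMap [CompleteSpace A] : ProjTensor A →L[ℂ] A :=
  (PiTensorProduct.liftIsometry ℂ (fun _ : Fin 2 => A) A (mulBilin A)).fromCompletion

theorem ProjTensor.leftAct_tmul (a b c : A) :
    ProjTensor.leftAct a ((PiTensorProduct.tprod ℂ ![b, c] : ⨂[ℂ] _ : Fin 2, A) : ProjTensor A)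
      = ((PiTensorProduct.tprod ℂ ![a * b, c] : ⨂[ℂ] _ : Fin 2, A) : ProjTensor A) := by
  rw [ProjTensor.leftAct, ContinuousLinearMap.completion_apply_coe, PiTensorProduct.mapL_apply,
    PiTensorProduct.map_tprod]
  congr 2
  ext i
  fin_cases i <;> simp

theorem ProjTensor.rightAct_tmul (a b c : A) :
    ProjTensor.rightAct a ((PiTensorProduct.tprod ℂ ![b, c] : ⨂[ℂ] _ : Fin 2, A) : ProjTensor A)
      = ((PiTensorProduct.tprod ℂ ![b, c * a] : ⨂[ℂ] _ : Fin 2, A) : ProjTensor A) := by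
  rw [ProjTensor.rightAct, ContinuousLinearMap.completion_apply_coe, PiTensorProduct.mapL_apply,
    PiTensorProduct.map_tprod]
  congr 2
  ext i
  fin_cases i <;> simp

theorem ProjTensor.prodMap_tmul [CompleteSpace A] (b c : A) :
    ProjTensor.prodMap A ((PiTensorProduct.tprod ℂ ![b, c] : ⨂[ℂ] _ : Fin 2, A) : ProjTensor A)
      = b * c := by
  rw [ProjTensor.prodMap, ContinuousLinearMap.fromCompletion_apply_coe,
    PiTensorProduct.liftIsometry_apply_apply, PiTensorProduct.lift.tprod]
  rfl

/-- A net `(m i)` in `A ⊗^ A` is an approximate diagonal if `a · m i - m i · a → 0` and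
`a π(m i) → a` in norm, for every `a ∈ A`. The net need not be bounded. -/
def IsApproximateDiagonal [CompleteSpace A] {ι : Type*} [Preorder ι] (m : ι → ProjTensor A) :
    Prop :=
  ∀ a : A,
    Tendsto (fun i => ProjTensor.leftAct a (m i) - ProjTensor.rightAct a (m i)) atTop (𝓝 0) ∧
    Tendsto (fun i => a * ProjTensor.prodMap A (m i)) atTop (𝓝 a)

variable (A) in
/-- A Banach algebra is pseudo-amenable if it has an approximate diagonal (indexed by a nonempty
directed set). -/
def PseudoAmenable [CompleteSpace A] : Prop :=
  ∃ (ι : Type u) (_ : Nonempty ι) (_ : Preorder ι) (_ : IsDirectedOrder ι)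
    (m : ι → ProjTensor A), IsApproximateDiagonal m

end PseudoAmenable

/-! ### Weights and Beurling algebras -/

/-- A weight on a topological group: a continuous submultiplicative function `G → (0, ∞)`. -/
structure GroupWeight (G : Type*) [Group G] [TopologicalSpace G] where
  toFun : G → ℝ
  continuous_toFun : Continuous toFun
  pos : ∀ g, 0 < toFun g
  mul_le : ∀ g h, toFun (g * h) ≤ toFun g * toFun h

instance {G : Type*} [Group G] [TopologicalSpace G] : CoeFun (GroupWeight G) (fun _ => G → ℝ) :=
  ⟨GroupWeight.toFun⟩

section Beurling

variable {G : Type*} [Group G] [TopologicalSpace G] [MeasurableSpace G]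

/-- The measure `ω dμ`. -/
noncomputable def weightedMeasure (μ : Measure G) (ω : GroupWeight G) : Measure G :=
  μ.withDensity (fun x => ENNReal.ofReal (ω x))

/-- The underlying space of `L¹(G, ω)`: (classes of) measurable functions `f : G → ℂ` with
`‖f‖ = ∫ |f| ω dμ < ∞`. -/
def BeurlingAlgebra (μ : Measure G) (ω : GroupWeight G) : Type _ :=
  Lp ℂ 1 (weightedMeasure μ ω)

namespace BeurlingAlgebra

variable {μ : Measure G} {ω : GroupWeight G}

noncomputable instance : NormedAddCommGroup (BeurlingAlgebra μ ω) :=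
  inferInstanceAs (NormedAddCommGroup (Lp ℂ 1 (weightedMeasure μ ω)))

noncomputable instance : NormedSpace ℂ (BeurlingAlgebra μ ω) :=
  inferInstanceAs (NormedSpace ℂ (Lp ℂ 1 (weightedMeasure μ ω)))

instance : CompleteSpace (BeurlingAlgebra μ ω) :=
  inferInstanceAs (CompleteSpace (Lp ℂ 1 (weightedMeasure μ ω)))

/-- The element of `Lp` underlying an element of `L¹(G, ω)`. -/
def toLp (f : BeurlingAlgebra μ ω) : Lp ℂ 1 (weightedMeasure μ ω) := f

/-- The element of `L¹(G, ω)` defined by a function. -/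
noncomputable def mk (f : G → ℂ) (hf : MemLp f 1 (weightedMeasure μ ω)) : BeurlingAlgebra μ ω :=
  MemLp.toLp f hf

noncomputable instance : CoeFun (BeurlingAlgebra μ ω) (fun _ => G → ℂ) :=
  ⟨fun f => ((toLp f : Lp ℂ 1 (weightedMeasure μ ω)) : G → ℂ)⟩

theorem ext_ae {f g : BeurlingAlgebra μ ω} (h : f =ᵐ[weightedMeasure μ ω] g) : f = g :=
  Lp.ext h

theorem coeFn_mk (f : G → ℂ) (hf : MemLp f 1 (weightedMeasure μ ω)) :
    mk f hf =ᵐ[weightedMeasure μ ω] f := MemLp.coeFn_toLp hf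

theorem coeFn_add (f g : BeurlingAlgebra μ ω) :
    ⇑(f + g) =ᵐ[weightedMeasure μ ω] fun x => f x + g x := Lp.coeFn_add (toLp f) (toLp g)

theorem coeFn_smul (c : ℂ) (f : BeurlingAlgebra μ ω) :
    ⇑(c • f) =ᵐ[weightedMeasure μ ω] fun x => c * f x := Lp.coeFn_smul c (toLp f)

theorem memLp (f : BeurlingAlgebra μ ω) : MemLp f 1 (weightedMeasure μ ω) := Lp.memLp (toLp f)

theorem weighted_ac : weightedMeasure μ ω ≪ μ := withDensity_absolutelyContinuous _ _

variable [BorelSpace G]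

theorem measurable_weight (ω : GroupWeight G) : Measurable fun x => ENNReal.ofReal (ω x) :=
  ω.continuous_toFun.measurable.ennreal_ofReal

theorem lintegral_weighted (F : G → ℝ≥0∞) :
    ∫⁻ x, F x ∂(weightedMeasure μ ω) = ∫⁻ x, ENNReal.ofReal (ω x) * F x ∂μ := by
  rw [weightedMeasure, lintegral_withDensity_eq_lintegral_mul_non_measurable _
    (measurable_weight ω) (by simp)]
  rfl

theorem ac_weighted : μ ≪ weightedMeasure μ ω :=
  withDensity_absolutelyContinuous' (measurable_weight ω).aemeasurable
    (by filter_upwards with x; simpa using ω.pos x)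

theorem enorm_def (f : BeurlingAlgebra μ ω) :
    ‖f‖ₑ = ∫⁻ x, ENNReal.ofReal (ω x) * ‖f x‖ₑ ∂μ := by
  rw [← lintegral_weighted, ← eLpNorm_one_eq_lintegral_enorm]
  exact Lp.enorm_def (toLp f)

/-- `‖f‖ = ∫ |f| ω dμ`. -/
theorem norm_eq (f : BeurlingAlgebra μ ω) : ‖f‖ = ∫ x, ‖f x‖ * ω x ∂μ := by
  have hf := (memLp f).1.mono_ac (ac_weighted (μ := μ) (ω := ω))
  rw [integral_eq_lintegral_of_nonneg_ae (f := fun x => ‖f x‖ * ω x)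
    (by filter_upwards with x; exact mul_nonneg (norm_nonneg _) (ω.pos x).le)
    (hf.norm.mul ω.continuous_toFun.measurable.aestronglyMeasurable), ← toReal_enorm, enorm_def]
  congr 2
  ext x
  rw [mul_comm, ENNReal.ofReal_mul (norm_nonneg _), ofReal_norm]

theorem integrable_norm_mul (f : BeurlingAlgebra μ ω) :
    Integrable (fun x => ‖f x‖ * ω x) μ := by
  have hf := (memLp f).1.mono_ac (ac_weighted (μ := μ) (ω := ω))
  refine ⟨hf.norm.mul ω.continuous_toFun.measurable.aestronglyMeasurable, ?_⟩
  have h : ‖f‖ₑ < ∞ := enorm_lt_top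
  rw [enorm_def] at h
  refine lt_of_le_of_lt (lintegral_mono fun x => ?_) h
  rw [enorm_mul, enorm_norm, mul_comm, Real.enorm_of_nonneg (ω.pos x).le]

variable [IsTopologicalGroup G] [μ.IsMulLeftInvariant]

theorem quasi_mul_left (y : G) :
    Measure.QuasiMeasurePreserving (fun x => y * x) (weightedMeasure μ ω)
      (weightedMeasure μ ω) := by
  refine ⟨measurable_const_mul y, ?_⟩
  have h1 : (weightedMeasure μ ω).map (fun x => y * x) ≪ μ.map (fun x => y * x) :=
    (weighted_ac (μ := μ) (ω := ω)).map (measurable_const_mul y)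
  rw [map_mul_left_eq_self μ y] at h1
  exact h1.trans ac_weighted

theorem lintegral_translate_le (y : G) (F : G → ℝ≥0∞) :
    ∫⁻ x, F (y⁻¹ * x) ∂(weightedMeasure μ ω) ≤
      ENNReal.ofReal (ω y) * ∫⁻ x, F x ∂(weightedMeasure μ ω) := by
  rw [lintegral_weighted, lintegral_weighted, ← lintegral_const_mul' _ _ (by simp),
    ← lintegral_mul_left_eq_self (μ := μ) (fun x => ENNReal.ofReal (ω x) * F (y⁻¹ * x)) y]
  refine lintegral_mono fun x => ?_
  simp only [inv_mul_cancel_left]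
  rw [← mul_assoc, ← ENNReal.ofReal_mul (ω.pos y).le]
  gcongr
  exact ω.mul_le y x

theorem memLp_translate (y : G) {f : G → ℂ} (hf : MemLp f 1 (weightedMeasure μ ω)) :
    MemLp (fun x => f (y⁻¹ * x)) 1 (weightedMeasure μ ω) := by
  refine ⟨hf.1.comp_quasiMeasurePreserving (quasi_mul_left y⁻¹), ?_⟩
  rw [eLpNorm_one_eq_lintegral_enorm]
  refine lt_of_le_of_lt (lintegral_translate_le y fun x => ‖f x‖ₑ) ?_
  rw [← eLpNorm_one_eq_lintegral_enorm]
  exact ENNReal.mul_lt_top (by simp) hf.2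

/-- Left translation on `L¹(G, ω)`: `(translate y f)(x) = f (y⁻¹ x)`. -/
noncomputable def translate (y : G) : BeurlingAlgebra μ ω →L[ℂ] BeurlingAlgebra μ ω :=
  LinearMap.mkContinuous
    { toFun := fun f => mk (fun x => f (y⁻¹ * x)) (memLp_translate y (memLp f))
      map_add' := by
        intro f g
        apply ext_ae
        filter_upwards [coeFn_mk _ (memLp_translate y (memLp (f + g))),
          coeFn_mk _ (memLp_translate y (memLp f)), coeFn_mk _ (memLp_translate y (memLp g)),
          coeFn_add (mk _ (memLp_translate y (memLp f))) (mk _ (memLp_translate y (memLp g))),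
          (quasi_mul_left y⁻¹).ae (coeFn_add f g)] with x h1 h2 h3 h4 h5
        rw [h1, h4, h2, h3, h5]
      map_smul' := by
        intro c f
        apply ext_ae
        filter_upwards [coeFn_mk _ (memLp_translate y (memLp (c • f))),
          coeFn_mk _ (memLp_translate y (memLp f)),
          coeFn_smul c (mk _ (memLp_translate y (memLp f))),
          (quasi_mul_left y⁻¹).ae (coeFn_smul c f)] with x h1 h2 h3 h4
        rw [RingHom.id_apply, h1, h3, h2, h4] }
    (ω y) (by
      intro f
      have h : ‖mk (fun x => f (y⁻¹ * x)) (memLp_translate y (memLp f))‖ₑ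
          ≤ ENNReal.ofReal (ω y) * ‖f‖ₑ := by
        rw [enorm_def f, ← lintegral_weighted]
        refine le_trans (le_of_eq ?_) (lintegral_translate_le y fun x => ‖f x‖ₑ)
        rw [enorm_def, ← lintegral_weighted]
        refine lintegral_congr_ae ?_
        filter_upwards [coeFn_mk _ (memLp_translate y (memLp f))] with x h1
        rw [h1]
      have h2 := ENNReal.toReal_mono (by finiteness) h
      rwa [ENNReal.toReal_mul, toReal_enorm, toReal_enorm,
        ENNReal.toReal_ofReal (ω.pos y).le] at h2)

theorem coeFn_translate (y : G) (f : BeurlingAlgebra μ ω) :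
    translate y f =ᵐ[weightedMeasure μ ω] fun x => f (y⁻¹ * x) :=
  coeFn_mk _ (memLp_translate y (memLp f))

theorem norm_translate_le (y : G) (f : BeurlingAlgebra μ ω) : ‖translate y f‖ ≤ ω y * ‖f‖ :=
  (translate y).le_of_opNorm_le (LinearMap.mkContinuous_norm_le _ (ω.pos y).le _) f

theorem translate_translate (y z : G) (f : BeurlingAlgebra μ ω) :
    translate y (translate z f) = translate (y * z) f := by
  apply ext_ae
  filter_upwards [coeFn_translate y (translate z f), coeFn_translate (y * z) f,
    (quasi_mul_left y⁻¹).ae (coeFn_translate z f)] with x h1 h2 h3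
  rw [h1, h2, h3, mul_inv_rev, mul_assoc]

/-- Convolution on `L¹(G, ω)`: `(f ∗ g)(x) = ∫ f(y) g(y⁻¹ x) dμ(y)`, as the absolutely convergent
Bochner integral `f ∗ g = ∫ f(y) (translate y g) dμ(y)` in `L¹(G, ω)`. -/
noncomputable def conv (f g : BeurlingAlgebra μ ω) : BeurlingAlgebra μ ω :=
  ∫ y, f y • translate y g ∂μ

/-! The integral converges absolutely, and makes `L¹(G, ω)` a Banach algebra. -/

theorem memLp_of_integrable {f : G → ℂ} (hf : Integrable (fun x => (ω x : ℂ) * f x) μ) :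
    MemLp f 1 (weightedMeasure μ ω) := by
  have hm : AEStronglyMeasurable f μ := by
    have h1 : AEStronglyMeasurable (fun x => ((ω x : ℂ))⁻¹ * ((ω x : ℂ) * f x)) μ :=
      (Complex.measurable_ofReal.comp
        ω.continuous_toFun.measurable).inv.aestronglyMeasurable.mul hf.1
    refine h1.congr (Eventually.of_forall fun x => ?_)
    have : (ω x : ℂ) ≠ 0 := by exact_mod_cast (ω.pos x).ne'
    simp [this]
  refine ⟨hm.mono_ac weighted_ac, ?_⟩
  rw [eLpNorm_one_eq_lintegral_enorm, lintegral_weighted]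
  refine lt_of_le_of_lt (lintegral_mono fun x => ?_) hf.2
  rw [enorm_mul, ← ofReal_norm (ω x : ℂ), Complex.norm_real, Real.norm_of_nonneg (ω.pos x).le]

variable [LocallyCompactSpace G] [T2Space G] [μ.Regular]

theorem memLp_of_hasCompactSupport {f : G → ℂ} (hf : Continuous f) (hc : HasCompactSupport f) :
    MemLp f 1 (weightedMeasure μ ω) :=
  memLp_of_integrable <| Continuous.integrable_of_hasCompactSupport
    ((Complex.continuous_ofReal.comp ω.continuous_toFun).mul hf) hc.mul_left

theorem exists_hasCompactSupport_eLpNorm_sub_le {f : G → ℂ} (hf : MemLp f 1 μ) {ε : ℝ≥0∞}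
    (hε : ε ≠ 0) :
    ∃ g : G → ℂ, eLpNorm (f - g) 1 μ ≤ ε ∧ Continuous g ∧ HasCompactSupport g := by
  refine hf.induction_dense ENNReal.one_ne_top
    (fun g => Continuous g ∧ HasCompactSupport g) ?_ ?_ ?_ hε
  · intro c s hs hμs ε hε
    set η : ℝ≥0∞ := ε / 2 / (‖c‖ₑ + 1) with hη
    have hη0 : η ≠ 0 :=
      ENNReal.div_ne_zero.2 ⟨ENNReal.div_ne_zero.2 ⟨hε, by simp⟩, by finiteness⟩
    obtain ⟨K, hKs, hK, hKμ⟩ := hs.exists_isCompact_sdiff_lt hμs.ne hη0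
    have hKfin : μ K ≠ ∞ := ((measure_mono hKs).trans_lt hμs).ne
    obtain ⟨V, hKV, hV, -, hVμ⟩ := hK.measurableSet.exists_isOpen_sdiff_lt hKfin hη0
    obtain ⟨u, hu1, hu0, huc, hu⟩ := exists_continuous_one_zero_of_isCompact hK
      hV.isClosed_compl (Set.disjoint_compl_right_iff_subset.2 hKV)
    refine ⟨fun x => (u x : ℂ) * c, ?_,
      (Complex.continuous_ofReal.comp u.continuous).mul continuous_const, ?_⟩
    · rw [eLpNorm_one_eq_lintegral_enorm]
      have hpt : ∀ x, ‖((fun x => (u x : ℂ) * c) - s.indicator fun _ => c) x‖ₑ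
          ≤ ((V \ K) ∪ (s \ K)).indicator (fun _ => ‖c‖ₑ) x := by
        intro x
        by_cases hxK : x ∈ K
        · have h1 : u x = 1 := hu1 hxK
          simp [h1, hKs hxK]
        by_cases hxV : x ∈ V
        · rw [Set.indicator_of_mem (show x ∈ (V \ K) ∪ (s \ K) from Or.inl ⟨hxV, hxK⟩), enorm_le_iff_norm_le]
          by_cases hxs : x ∈ s
          · have h2 : (u x : ℂ) * c - c = ((u x - 1 : ℝ) : ℂ) * c := by push_cast; ring
            simp only [Pi.sub_apply, Set.indicator_of_mem hxs]
            rw [h2, norm_mul, Complex.norm_real, Real.norm_eq_abs]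
            refine mul_le_of_le_one_left (norm_nonneg _) (abs_le.2 ⟨?_, ?_⟩)
            · linarith [(hu x).1]
            · linarith [(hu x).2]
          · simp only [Pi.sub_apply, Set.indicator_of_notMem hxs, sub_zero]
            rw [norm_mul, Complex.norm_real, Real.norm_eq_abs, abs_of_nonneg (hu x).1]
            exact mul_le_of_le_one_left (norm_nonneg _) (hu x).2
        · have h0 : u x = 0 := hu0 hxV
          by_cases hxs : x ∈ s
          · rw [Set.indicator_of_mem (show x ∈ (V \ K) ∪ (s \ K) from Or.inr ⟨hxs, hxK⟩)]
            simp [h0, hxs]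
          · simp [h0, hxs]
      calc ∫⁻ x, ‖((fun x => (u x : ℂ) * c) - s.indicator fun _ => c) x‖ₑ ∂μ
          ≤ ∫⁻ x, ((V \ K) ∪ (s \ K)).indicator (fun _ => ‖c‖ₑ) x ∂μ := lintegral_mono hpt
        _ ≤ ‖c‖ₑ * μ ((V \ K) ∪ (s \ K)) := lintegral_indicator_const_le _ _
        _ ≤ (‖c‖ₑ + 1) * (η + η) := by
          gcongr
          · exact le_self_add
          · exact (measure_union_le _ _).trans (add_le_add hVμ.le hKμ.le)
        _ = ε := by
          rw [mul_add, hη, ENNReal.mul_div_cancel (by simp) (by finiteness), ENNReal.add_halves]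
    · exact HasCompactSupport.mul_right (f := fun x => (u x : ℂ))
        (huc.comp_left Complex.ofReal_zero)
  · exact fun f g hf hg => ⟨hf.1.add hg.1, hf.2.add hg.2⟩
  · exact fun f hf => (hf.1.integrable_of_hasCompactSupport hf.2).aestronglyMeasurable

/-- Continuous functions with compact support are dense in `L¹(G, ω)`. -/
theorem exists_hasCompactSupport (f : BeurlingAlgebra μ ω) {ε : ℝ} (hε : 0 < ε) :
    ∃ (g : G → ℂ) (hg : Continuous g) (hc : HasCompactSupport g),
      ‖f - mk g (memLp_of_hasCompactSupport hg hc)‖ ≤ ε := by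
  have hm := (memLp f).1.mono_ac (ac_weighted (μ := μ) (ω := ω))
  have hi : Integrable (fun x => (ω x : ℂ) * f x) μ := by
    refine (integrable_norm_mul f).mono ((Complex.measurable_ofReal.comp
        ω.continuous_toFun.measurable).aestronglyMeasurable.mul hm)
        (Eventually.of_forall fun x => ?_)
    simp [mul_comm]
  obtain ⟨h, hle', hcont, hc⟩ := exists_hasCompactSupport_eLpNorm_sub_le
    (memLp_one_iff_integrable.2 hi) (ε := ENNReal.ofReal ε) (by simpa using hε)
  have hle : ∫ x, ‖(ω x : ℂ) * f x - h x‖ ∂μ ≤ ε := by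
    rw [integral_norm_eq_lintegral_enorm (f := fun x => (ω x : ℂ) * f x - h x)
      (hi.1.sub (hcont.integrable_of_hasCompactSupport hc).1)]
    rw [eLpNorm_one_eq_lintegral_enorm] at hle'
    exact ENNReal.toReal_le_of_le_ofReal hε.le hle'
  have hne : ∀ x, (ω x : ℂ) ≠ 0 := fun x => by exact_mod_cast (ω.pos x).ne'
  have hg : Continuous fun x => (ω x : ℂ)⁻¹ * h x :=
    ((Complex.continuous_ofReal.comp ω.continuous_toFun).inv₀ hne).mul hcont
  have hgc : HasCompactSupport fun x => (ω x : ℂ)⁻¹ * h x := hc.mul_left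
  refine ⟨_, hg, hgc, le_trans (le_of_eq ?_) hle⟩
  rw [norm_eq]
  refine integral_congr_ae ?_
  have h1 : ⇑(f - mk _ (memLp_of_hasCompactSupport (μ := μ) (ω := ω) hg hgc)) =ᵐ[μ] _ :=
    ac_weighted (Lp.coeFn_sub (toLp f) (toLp (mk _ (memLp_of_hasCompactSupport hg hgc))))
  have h2 := ac_weighted (coeFn_mk _ (memLp_of_hasCompactSupport (μ := μ) (ω := ω) hg hgc))
  filter_upwards [h1, h2] with x h1 h2
  rw [h1, Pi.sub_apply, h2]
  have : (ω x : ℂ) * f x - h x = (ω x : ℂ) * (f x - (ω x : ℂ)⁻¹ * h x) := by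
    field_simp [hne x]
  rw [this, norm_mul, Complex.norm_real, Real.norm_of_nonneg (ω.pos x).le, mul_comm]

theorem continuous_translate (g : BeurlingAlgebra μ ω) :
    Continuous fun y => translate y g := by
  rw [continuous_iff_continuousAt]
  intro y₀
  obtain ⟨K, hK, hyK⟩ := exists_compact_mem_nhds y₀
  obtain ⟨C, hC⟩ := hK.bddAbove_image ω.continuous_toFun.continuousOn
  have hC' : ∀ y ∈ K, ω y ≤ C := fun y hy => hC ⟨y, hy, rfl⟩
  have hy₀ : y₀ ∈ K := mem_of_mem_nhds hyK
  have hCpos : 0 < C := (ω.pos y₀).trans_le (hC' y₀ hy₀)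
  rw [ContinuousAt, tendsto_iff_norm_sub_tendsto_zero, Metric.tendsto_nhds]
  intro ε hε
  obtain ⟨h, hh, hc, hle⟩ := exists_hasCompactSupport g (ε := ε / (4 * C)) (by positivity)
  set k : BeurlingAlgebra μ ω := mk h (memLp_of_hasCompactSupport hh hc) with hk
  have key : ContinuousOn (fun y => ∫ x, ‖h (y⁻¹ * x) - h (y₀⁻¹ * x)‖ * ω x ∂μ) K := by
    refine continuousOn_integral_of_compact_support 
      (k := (fun p : G × G => p.1 * p.2) '' (K ×ˢ tsupport h))
      ((hK.prod hc).image continuous_mul) ?_ ?_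
    · have := ω.continuous_toFun
      refine Continuous.continuousOn ?_
      unfold Function.uncurry
      fun_prop
    · intro y x hy hx
      have aux : ∀ z ∈ K, h (z⁻¹ * x) = 0 := by
        intro z hz
        by_contra hne
        exact hx ⟨(z, z⁻¹ * x), ⟨hz, subset_tsupport _ hne⟩, by simp⟩
      simp [aux y hy, aux y₀ hy₀]
  have hnorm : ∀ y, ‖translate y k - translate y₀ k‖
      = ∫ x, ‖h (y⁻¹ * x) - h (y₀⁻¹ * x)‖ * ω x ∂μ := by
    intro y
    rw [norm_eq]
    refine integral_congr_ae ?_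
    have h0 := coeFn_mk h (memLp_of_hasCompactSupport (μ := μ) (ω := ω) hh hc)
    have e1 : ⇑(translate y k - translate y₀ k) =ᵐ[μ] _ :=
      ac_weighted (Lp.coeFn_sub (toLp (translate y k)) (toLp (translate y₀ k)))
    filter_upwards [e1, ac_weighted (coeFn_translate y k), ac_weighted (coeFn_translate y₀ k),
      ac_weighted ((quasi_mul_left y⁻¹).ae h0), ac_weighted ((quasi_mul_left y₀⁻¹).ae h0)]
      with x e1 e2 e3 e4 e5
    rw [e1, Pi.sub_apply, e2, e3, e4, e5]
  have key2 := key.continuousAt hyK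
  rw [ContinuousAt, Metric.tendsto_nhds] at key2
  filter_upwards [key2 (ε / 2) (by positivity), hyK] with y hy hyK'
  have h0 : ‖translate y k - translate y₀ k‖ < ε / 2 := by
    rw [hnorm]
    have h1 : (0 : ℝ) ≤ ∫ x, ‖h (y⁻¹ * x) - h (y₀⁻¹ * x)‖ * ω x ∂μ := by
      rw [← hnorm]
      exact norm_nonneg _
    simpa [Real.dist_eq, abs_of_nonneg h1] using hy
  have bd : ∀ z ∈ K, ‖translate z (g - k)‖ ≤ ε / 4 := by
    intro z hz
    refine (norm_translate_le z _).trans ?_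
    calc ω z * ‖g - k‖ ≤ C * (ε / (4 * C)) :=
          mul_le_mul (hC' z hz) hle (norm_nonneg _) hCpos.le
      _ = ε / 4 := by field_simp
  have hsplit : translate y g - translate y₀ g
      = (translate y k - translate y₀ k) + (translate y (g - k) - translate y₀ (g - k)) := by
    simp only [map_sub]
    abel
  rw [Real.dist_eq, sub_zero, abs_of_nonneg (norm_nonneg _), hsplit]
  have b1 := norm_add_le (translate y k - translate y₀ k)
    (translate y (g - k) - translate y₀ (g - k))
  have b2 := norm_sub_le (translate y (g - k)) (translate y₀ (g - k))
  have b3 := bd y hyK'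
  have b4 := bd y₀ hy₀
  linarith

theorem aestronglyMeasurable_smul {E : Type*} [NormedAddCommGroup E] [NormedSpace ℂ E]
    (f : BeurlingAlgebra μ ω) {u : G → E} (hu : Continuous u) :
    AEStronglyMeasurable (fun y => f y • u y) μ := by
  choose g hg hc hle using fun n : ℕ =>
    exists_hasCompactSupport f (ε := 1 / ((n : ℝ) + 1)) (by positivity)
  have ht : Tendsto (fun n => mk (g n) (memLp_of_hasCompactSupport (hg n) (hc n))) atTop (𝓝 f) := by
    rw [tendsto_iff_norm_sub_tendsto_zero]
    refine squeeze_zero (fun _ => norm_nonneg _) (fun n => ?_)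
      tendsto_one_div_add_atTop_nhds_zero_nat
    rw [norm_sub_rev]
    exact hle n
  obtain ⟨ns, -, hns⟩ := (tendstoInMeasure_of_tendsto_Lp
    (f := fun n => toLp (mk (g n) (memLp_of_hasCompactSupport (hg n) (hc n))))
    (g := toLp f) ht).exists_seq_tendsto_ae
  have hall : ∀ᵐ x ∂μ, ∀ n, mk (g n) (memLp_of_hasCompactSupport (μ := μ) (ω := ω) (hg n) (hc n)) x
      = g n x := ae_all_iff.2 fun n => ac_weighted (coeFn_mk _ _)
  refine aestronglyMeasurable_of_tendsto_ae atTop (f := fun n y => g (ns n) y • u y)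
    (fun n => ?_) ?_
  · exact (((hg _).smul hu).stronglyMeasurable_of_hasCompactSupport
      (hc _).smul_right).aestronglyMeasurable
  · filter_upwards [ac_weighted hns, hall] with x h1 h2
    refine Tendsto.smul_const ?_ _
    simpa only [h2] using h1

theorem integrable_conv (f g : BeurlingAlgebra μ ω) :
    Integrable (fun y => f y • translate y g) μ := by
  refine ((integrable_norm_mul f).mul_const ‖g‖).mono'
    (aestronglyMeasurable_smul f (continuous_translate g)) (Eventually.of_forall fun y => ?_)
  rw [norm_smul, mul_assoc]
  exact mul_le_mul_of_nonneg_left (norm_translate_le y g) (norm_nonneg _)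

theorem norm_conv_le (f g : BeurlingAlgebra μ ω) : ‖conv f g‖ ≤ ‖f‖ * ‖g‖ := by
  rw [norm_eq f, ← integral_mul_const]
  refine norm_integral_le_of_norm_le ((integrable_norm_mul f).mul_const _)
    (Eventually.of_forall fun y => ?_)
  rw [norm_smul, mul_assoc]
  exact mul_le_mul_of_nonneg_left (norm_translate_le y g) (norm_nonneg _)

theorem add_conv (f f' g : BeurlingAlgebra μ ω) : conv (f + f') g = conv f g + conv f' g := by
  rw [conv, conv, conv, ← integral_add (integrable_conv f g) (integrable_conv f' g)]
  refine integral_congr_ae ?_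
  filter_upwards [ac_weighted (coeFn_add f f')] with y hy
  rw [hy, add_smul]

theorem conv_add (f g g' : BeurlingAlgebra μ ω) : conv f (g + g') = conv f g + conv f g' := by
  rw [conv, conv, conv, ← integral_add (integrable_conv f g) (integrable_conv f g')]
  simp only [map_add, smul_add]

theorem smul_conv (c : ℂ) (f g : BeurlingAlgebra μ ω) : conv (c • f) g = c • conv f g := by
  rw [conv, conv, ← integral_smul]
  refine integral_congr_ae ?_
  filter_upwards [ac_weighted (coeFn_smul c f)] with y hy
  rw [hy, mul_smul]

theorem conv_smul (c : ℂ) (f g : BeurlingAlgebra μ ω) : conv f (c • g) = c • conv f g := by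
  rw [conv, conv, ← integral_smul]
  simp only [map_smul, smul_comm c]

/-- Convolution on the right by a fixed element, as a bounded operator. -/
noncomputable def convRight (g : BeurlingAlgebra μ ω) :
    BeurlingAlgebra μ ω →L[ℂ] BeurlingAlgebra μ ω :=
  LinearMap.mkContinuous
    { toFun := fun f => conv f g
      map_add' := fun f f' => add_conv f f' g
      map_smul' := fun c f => smul_conv c f g }
    ‖g‖ (fun f => by rw [mul_comm]; exact norm_conv_le f g)

theorem convRight_apply (f g : BeurlingAlgebra μ ω) : convRight g f = conv f g := rfl

theorem translate_conv (y : G) (f g : BeurlingAlgebra μ ω) :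
    conv (translate y f) g = translate y (conv f g) := by
  rw [conv, conv, ← (translate y).integral_comp_comm (integrable_conv f g),
    ← integral_mul_left_eq_self (μ := μ) (fun z => (translate y f) z • translate z g) y]
  refine integral_congr_ae ?_
  have h := (quasi_mul_left (μ := μ) (ω := ω) y).ae (coeFn_translate y f)
  filter_upwards [ac_weighted h] with z hz
  rw [hz, inv_mul_cancel_left, map_smul, translate_translate]

theorem conv_assoc (f g h : BeurlingAlgebra μ ω) : conv (conv f g) h = conv f (conv g h) := by
  rw [← convRight_apply (conv f g) h, conv,
    ← (convRight h).integral_comp_comm (integrable_conv f g)]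
  simp only [map_smul, convRight_apply, translate_conv]
  rfl

noncomputable instance : NonUnitalNormedRing (BeurlingAlgebra μ ω) :=
  { (inferInstance : NormedAddCommGroup (BeurlingAlgebra μ ω)) with
    mul := conv
    left_distrib := conv_add
    right_distrib := add_conv
    zero_mul := fun f => (convRight f).map_zero
    mul_zero := fun f => by
      change conv f 0 = 0
      simp [conv]
    mul_assoc := conv_assoc
    norm_mul_le := norm_conv_le }

theorem mul_def (f g : BeurlingAlgebra μ ω) : f * g = ∫ y, f y • translate y g ∂μ := rfl

instance : IsScalarTower ℂ (BeurlingAlgebra μ ω) (BeurlingAlgebra μ ω) :=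
  ⟨fun c f g => smul_conv c f g⟩

instance : SMulCommClass ℂ (BeurlingAlgebra μ ω) (BeurlingAlgebra μ ω) :=
  ⟨fun c f g => (conv_smul c f g).symm⟩

end BeurlingAlgebra

end Beurling

/-! The proof turns on whether `G` has a left invariant mean on its bounded continuous functions
(`exists_invariant_mean_or`). If it does, averaging the bounded cocycle `x ↦ log ω(gx) - log ω(x)`
over `x` gives an additive function of `g` lying below `log ω`, and its exponential is the
character. It remains to see that without a mean the algebra is not pseudo-amenable.

Without a mean, a Hahn-Banach argument and a normalisation produce a Markov transition on `G`,
moving `x` to `t_j x` with probability `q_j x`, that pushes a density `v` with `1 ≤ v ≤ V` to at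
most `θ v`, where `θ < 1` (`exists_contracting_flow`). Hence the weights `Q_w` of the words of
length `n` have a sum of order `θ^n`, uniformly on `G`.

An approximate diagonal is tested against `B_n(f ⊗ g) = ∑_{|w| = n} κ_w((Q_w f) * g * a)`, where
`κ_w(δ_y * a) = k(p_w⁻¹ y p_w)` for one bump `k`, with `p_w` the product along `w`. On the net,
`B_0` tends to `k(1) = 1`. But `B_{n+1} - B_n` involves only commutators with the finitely many
elements `a` and `δ_{t_j} * a`, with geometrically decaying coefficients, and `B_n(M) → 0` for each
fixed `M`. Summing over `n` bounds `B_0` by these commutators, so it tends to `0`. No bound on the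
net enters (`not_pseudoAmenable_of_flow`).

This needs a single `a` for all words, with `‖κ_w‖ ≤ C η^{-|w|}` and `θ < η < 1`. Conjugates of `k`
are uniformly dominated by `ω` because the growth of a weight along powers is insensitive to
conjugation (`one_le_mul_inv_conj`). Damping by `η^{|w|}` makes the whole family uniformly
continuous relative to `ω`, and Cohen factorization turns it into a matrix coefficient
(`exists_conj_coefficients`). -/

section CohenFactorization

/-! ### Cohen factorization -/

variable {A E : Type*} [NonUnitalNormedRing A] [NormedSpace ℂ A] [CompleteSpace A]
  [NormedAddCommGroup E] [NormedSpace ℂ E] [CompleteSpace E]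

theorem norm_inverse_one_sub_le (T : E →L[ℂ] E) (hT : ‖T‖ ≤ 1 / 2) (x : E) :
    ‖Ring.inverse (1 - T) x‖ ≤ 2 * ‖x‖ := by
  have hu : IsUnit (1 - T) := isUnit_one_sub_of_norm_lt_one (by linarith)
  have h : (1 - T) (Ring.inverse (1 - T) x) = x := by
    have := congrArg (fun S : E →L[ℂ] E => S x) (Ring.mul_inverse_cancel _ hu)
    simpa using this
  set y := Ring.inverse (1 - T) x
  have h1 : y = x + T y := by rw [← h]; simp
  have h2 : ‖T y‖ ≤ 1 / 2 * ‖y‖ := T.le_of_opNorm_le hT y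
  have h3 : ‖y‖ ≤ ‖x‖ + ‖T y‖ := by
    conv_lhs => rw [h1]
    exact norm_add_le _ _
  linarith

/-- The inductive step of Cohen's construction. -/
theorem cohen_step (ρ : A →L[ℂ] (E →L[ℂ] E)) (hρ : ∀ a b, ρ (a * b) = ρ a * ρ b) (x : E) {K c : ℝ}
    (hc : 0 < c) (hcK : c * (1 + ‖ρ‖ * K) ≤ 1 / 2)
    (happ : ∀ ε > 0, ∀ b : A, ∃ e, ‖e‖ ≤ K ∧ ‖e * b - b‖ < ε ∧ ‖ρ e x - x‖ < ε)
    (r : ℝ) (b : A) (hS : IsUnit ((r : ℂ) • 1 + ρ b)) {δ : ℝ} (hδ : 0 < δ) :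
    ∃ e : A, ‖e‖ ≤ K ∧ IsUnit ((((1 - c) * r : ℝ) : ℂ) • (1 : E →L[ℂ] E) + ρ (b + ((c * r : ℝ) : ℂ) • e)) ∧
      ‖Ring.inverse ((((1 - c) * r : ℝ) : ℂ) • 1 + ρ (b + ((c * r : ℝ) : ℂ) • e)) x -
        Ring.inverse ((r : ℂ) • 1 + ρ b) x‖ < δ := by
  choose e heK heb hex using fun n : ℕ => happ (1 / ((n : ℝ) + 1)) (by positivity) b
  have htz : Tendsto (fun n : ℕ => 1 / ((n : ℝ) + 1)) atTop (𝓝 0) :=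
    tendsto_one_div_add_atTop_nhds_zero_nat
  -- `1 - T n = (1 - c) + c ρ(e n)` is the factor split off at this stage; the choice of `c` makes
  -- `T n` small however large `K` is.
  set T : ℕ → (E →L[ℂ] E) := fun n => (c : ℂ) • (1 - ρ (e n)) with hT
  have hTn : ∀ n, ‖T n‖ ≤ 1 / 2 := by
    intro n
    refine le_trans ?_ hcK
    rw [hT]
    simp only [norm_smul, Complex.norm_real, Real.norm_of_nonneg hc.le]
    refine mul_le_mul_of_nonneg_left ?_ hc.le
    refine (norm_sub_le _ _).trans (add_le_add ContinuousLinearMap.norm_id_le ?_)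
    exact (ρ.le_opNorm _).trans (mul_le_mul_of_nonneg_left (heK n) (norm_nonneg _))
  have hTu : ∀ n, IsUnit (1 - T n) := fun n =>
    isUnit_one_sub_of_norm_lt_one ((hTn n).trans_lt (by norm_num))
  set J : ℕ → (E →L[ℂ] E) := fun n => Ring.inverse (1 - T n) with hJ
  have hJl : ∀ n, J n * (1 - T n) = 1 := fun n => Ring.inverse_mul_cancel _ (hTu n)
  have hJr : ∀ n, (1 - T n) * J n = 1 := fun n => Ring.mul_inverse_cancel _ (hTu n)
  have hJn : ∀ n z, ‖J n z‖ ≤ 2 * ‖z‖ := fun n z => norm_inverse_one_sub_le _ (hTn n) z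
  have hJop : ∀ n, ‖J n‖ ≤ 2 := fun n => (J n).opNorm_le_bound (by norm_num) (hJn n)
  have hJ1 : ∀ n, J n - 1 = J n * T n := by
    intro n
    have := hJl n
    rw [mul_sub, mul_one] at this
    rw [← this]; abel
  have hR : Tendsto (fun n => (r : ℂ) • 1 + J n * ρ b) atTop (𝓝 ((r : ℂ) • 1 + ρ b)) := by
    refine Tendsto.const_add _ ?_
    rw [tendsto_iff_norm_sub_tendsto_zero]
    have hz : Tendsto (fun n : ℕ => 2 * (c * (‖ρ‖ * (1 / ((n : ℝ) + 1))))) atTop (𝓝 0) := by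
      simpa using ((htz.const_mul ‖ρ‖).const_mul c).const_mul 2
    refine squeeze_zero (fun _ => norm_nonneg _) (fun n => ?_) hz
    -- `T n` nearly kills `ρ b`, because `e n` is almost a left unit for `b`; hence its resolvent `J
    -- n` almost fixes `ρ b`.
    have : J n * ρ b - ρ b = J n * ((c : ℂ) • ρ (b - e n * b)) := by
      calc J n * ρ b - ρ b = (J n - 1) * ρ b := by rw [sub_mul, one_mul]
        _ = _ := by rw [hJ1, mul_assoc, hT]; simp only [smul_mul_assoc, sub_mul, one_mul, map_sub, hρ]
    rw [this]
    refine (norm_mul_le _ _).trans ?_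
    rw [norm_smul, Complex.norm_real, Real.norm_of_nonneg hc.le]
    have h2 := ρ.le_opNorm (b - e n * b)
    rw [norm_sub_rev] at h2
    gcongr
    · exact hJop n
    · exact h2.trans (mul_le_mul_of_nonneg_left (heb n).le (norm_nonneg _))
  have hx : Tendsto (fun n => J n x) atTop (𝓝 x) := by
    rw [tendsto_iff_norm_sub_tendsto_zero]
    have hz : Tendsto (fun n : ℕ => 2 * (c * (1 / ((n : ℝ) + 1)))) atTop (𝓝 0) := by
      simpa using (htz.const_mul c).const_mul 2
    refine squeeze_zero (fun _ => norm_nonneg _) (fun n => ?_) hz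
    have : J n x - x = J n ((c : ℂ) • (x - ρ (e n) x)) := by
      have := congrArg (fun S : E →L[ℂ] E => S x) (hJ1 n)
      simpa [hT] using this
    rw [this]
    refine (hJn n _).trans ?_
    rw [norm_smul, Complex.norm_real, Real.norm_of_nonneg hc.le, norm_sub_rev]
    gcongr
    exact (hex n).le
  obtain ⟨u, hu⟩ := hS
  have hinv : Tendsto (fun n => Ring.inverse ((r : ℂ) • 1 + J n * ρ b)) atTop
      (𝓝 (Ring.inverse ((r : ℂ) • 1 + ρ b))) := by
    have := NormedRing.inverse_continuousAt u
    rw [hu] at this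
    exact this.tendsto.comp hR
  have hlim : Tendsto (fun n => Ring.inverse ((r : ℂ) • 1 + J n * ρ b) (J n x)) atTop
      (𝓝 (Ring.inverse ((r : ℂ) • 1 + ρ b) x)) :=
    (isBoundedBilinearMap_apply.continuous.tendsto (Ring.inverse ((r : ℂ) • 1 + ρ b), x)).comp
      (hinv.prodMk_nhds hx)
  have hunit : ∀ᶠ n in atTop, IsUnit ((r : ℂ) • 1 + J n * ρ b) := by
    refine hR.eventually ?_
    rw [← hu]
    exact u.nhds
  rw [tendsto_iff_norm_sub_tendsto_zero] at hlim
  obtain ⟨n, hn1, hn2⟩ := (hunit.and (hlim.eventually (gt_mem_nhds hδ))).exists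
  -- The new operator is `1 - T n` times a perturbation of the old one, so its inverse at `x` is
  -- close to the old inverse at `J n x`, and `J n x` is close to `x`.
  have hfac : (((1 - c) * r : ℝ) : ℂ) • (1 : E →L[ℂ] E) + ρ (b + ((c * r : ℝ) : ℂ) • e n)
      = (1 - T n) * ((r : ℂ) • 1 + J n * ρ b) := by
    rw [mul_add, ← mul_assoc, hJr, one_mul, map_add, map_smul, hT]
    simp only [mul_smul_comm, mul_one, smul_sub, Complex.ofReal_mul, Complex.ofReal_sub,
      Complex.ofReal_one]
    module
  refine ⟨e n, heK n, ?_, ?_⟩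
  · have := (hTu n).mul hn1
    rw [← hfac] at this
    exact this
  · have hinv2 : Ring.inverse ((1 - T n) * ((r : ℂ) • 1 + J n * ρ b))
        = Ring.inverse ((r : ℂ) • 1 + J n * ρ b) * J n := by
      simp only [hJ] at hn1 ⊢
      obtain ⟨v, hv⟩ := hTu n
      obtain ⟨w, hw⟩ := hn1
      rw [← hw, ← hv, ← Units.val_mul, Ring.inverse_unit, Ring.inverse_unit, Ring.inverse_unit,
        mul_inv_rev, Units.val_mul]
    rw [hfac, hinv2]
    exact hn2

/-- **Cohen's factorization theorem** for a Banach space acted on by a Banach algebra with a bounded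
left approximate identity. -/
theorem cohen_factorization (ρ : A →L[ℂ] (E →L[ℂ] E)) (hρ : ∀ a b, ρ (a * b) = ρ a * ρ b) (x : E)
    {K : ℝ} (happ : ∀ ε > 0, ∀ b : A, ∃ e, ‖e‖ ≤ K ∧ ‖e * b - b‖ < ε ∧ ‖ρ e x - x‖ < ε) :
    ∃ a y, ρ a y = x := by
  have hK : 0 ≤ K := by
    obtain ⟨e, he, -⟩ := happ 1 one_pos 0
    exact (norm_nonneg e).trans he
  obtain ⟨c, hc, hc1, hcK⟩ : ∃ c : ℝ, 0 < c ∧ c < 1 ∧ c * (1 + ‖ρ‖ * K) ≤ 1 / 2 := by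
    have h0 : 0 ≤ ‖ρ‖ * K := by positivity
    refine ⟨1 / (2 * (1 + ‖ρ‖ * K)), by positivity, ?_, ?_⟩
    · rw [div_lt_one (by positivity)]; linarith
    · apply le_of_eq; field_simp
  choose! e heK heu hed using fun (n : ℕ) (b : A) (hS : IsUnit ((((1 - c) ^ n : ℝ) : ℂ) • 1 + ρ b)) =>
    cohen_step ρ hρ x hc hcK happ ((1 - c) ^ n) b hS (δ := (1 / 2) ^ n) (by positivity)
  let b : ℕ → A := fun n => Nat.rec 0 (fun n b => b + ((c * (1 - c) ^ n : ℝ) : ℂ) • e n b) n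
  have hb : ∀ n, b (n + 1) = b n + ((c * (1 - c) ^ n : ℝ) : ℂ) • e n (b n) := fun n => rfl
  have hpow : ∀ n, (1 - c) * (1 - c) ^ n = (1 - c) ^ (n + 1) := fun n => by ring
  have hS : ∀ n, IsUnit ((((1 - c) ^ n : ℝ) : ℂ) • 1 + ρ (b n)) := by
    intro n
    induction n with
    | zero => simp [b]
    | succ n ih =>
      have := heu n (b n) ih
      rw [hpow, ← hb] at this
      exact this
  -- Each `S n` is invertible with `S n (y n) = x`. Its scalar part decays geometrically, so in the
  -- limit only `ρ a` is left.
  set S : ℕ → (E →L[ℂ] E) := fun n => (((1 - c) ^ n : ℝ) : ℂ) • 1 + ρ (b n) with hSdef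
  set y : ℕ → E := fun n => Ring.inverse (S n) x with hy
  have hyc : CauchySeq y := by
    refine cauchySeq_of_le_geometric (1 / 2) 1 (by norm_num) fun n => ?_
    rw [dist_comm, dist_eq_norm, one_mul]
    have := hed n (b n) (hS n)
    rw [hpow, ← hb] at this
    exact this.le
  have hbc : CauchySeq b := by
    refine cauchySeq_of_le_geometric (1 - c) (c * K) (by linarith) fun n => ?_
    rw [dist_comm, dist_eq_norm, hb, add_sub_cancel_left, norm_smul, Complex.norm_real,
      Real.norm_of_nonneg (mul_nonneg hc.le (pow_nonneg (by linarith) _))]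
    have := heK n (b n) (hS n)
    have h1 : 0 ≤ c * (1 - c) ^ n := mul_nonneg hc.le (pow_nonneg (by linarith) _)
    nlinarith
  obtain ⟨y₀, hy₀⟩ := cauchySeq_tendsto_of_complete hyc
  obtain ⟨a, ha⟩ := cauchySeq_tendsto_of_complete hbc
  refine ⟨a, y₀, ?_⟩
  have hSlim : Tendsto S atTop (𝓝 (ρ a)) := by
    have h1 : Tendsto (fun n : ℕ => (((1 - c) ^ n : ℝ) : ℂ)) atTop (𝓝 ((0 : ℝ) : ℂ)) :=
      (Complex.continuous_ofReal.tendsto 0).comp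
        (tendsto_pow_atTop_nhds_zero_of_lt_one (by linarith) (by linarith))
    have h2 := (h1.smul_const (1 : E →L[ℂ] E)).add ((ρ.continuous.tendsto a).comp ha)
    rw [Complex.ofReal_zero, zero_smul, zero_add] at h2
    exact h2
  have hconst : ∀ n, S n (y n) = x := by
    intro n
    exact congrArg (fun S : E →L[ℂ] E => S x) (Ring.mul_inverse_cancel _ (hS n))
  have := (isBoundedBilinearMap_apply.continuous.tendsto (ρ a, y₀)).comp (hSlim.prodMk_nhds hy₀)
  simp only [Function.comp_def, hconst] at this
  exact tendsto_nhds_unique this tendsto_const_nhds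

end CohenFactorization

/-! ### Bumps and matrix coefficients of the translation action -/

section BeurlingFactorization

variable {G : Type*} [Group G] [TopologicalSpace G] [IsTopologicalGroup G]
  [LocallyCompactSpace G] [T2Space G]

/-- A normalised Urysohn function at the identity of a locally compact group. -/
theorem exists_continuous_one_at_one {U : Set G} (hU : U ∈ 𝓝 (1 : G)) :
    ∃ k : G → ℝ, Continuous k ∧ HasCompactSupport k ∧ (∀ x, 0 ≤ k x) ∧ (∀ x, k x ≤ 1) ∧
      (∀ x ∉ U, k x = 0) ∧ k 1 = 1 := by
  obtain ⟨k, h1, h0, hc, hk⟩ := exists_continuous_one_zero_of_isCompact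
    (isCompact_singleton (x := (1 : G))) (isOpen_interior (s := U)).isClosed_compl
    (by simpa [Set.disjoint_compl_right_iff_subset] using mem_interior_iff_mem_nhds.2 hU)
  refine ⟨k, k.continuous, hc, fun x => (hk x).1, fun x => (hk x).2, fun x hx => ?_, ?_⟩
  · exact h0 fun h => hx (interior_subset h)
  · exact h1 rfl

variable [MeasurableSpace G] [BorelSpace G]

/-- `e` is a continuous, compactly supported probability density vanishing off `U`. -/
structure IsBump (μ : Measure G) (U : Set G) (e : G → ℝ) : Prop where
  continuous : Continuous e
  hasCompactSupport : HasCompactSupport e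
  nonneg : ∀ x, 0 ≤ e x
  eq_zero : ∀ x ∉ U, e x = 0
  integral_eq_one : ∫ x, e x ∂μ = 1

variable {μ : Measure G} [μ.IsHaarMeasure] [μ.Regular]

variable (μ) in
theorem exists_isBump {U : Set G} (hU : U ∈ 𝓝 (1 : G)) : ∃ e, IsBump μ U e := by
  obtain ⟨k, hk, hc, h0, -, hkU, hk1⟩ := exists_continuous_one_at_one hU
  have hpos : 0 < ∫ x, k x ∂μ :=
    hk.integral_pos_of_hasCompactSupport_nonneg_nonzero hc h0 (x := 1) (by simp [hk1])
  refine ⟨fun x => (∫ x, k x ∂μ)⁻¹ * k x, continuous_const.mul hk, hc.mul_left,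
    fun x => mul_nonneg (inv_nonneg.2 hpos.le) (h0 x), fun x hx => by simp [hkU x hx], ?_⟩
  rw [integral_const_mul, inv_mul_cancel₀ hpos.ne']

/-- A bump has mass one, so `v` is its own average and only the oscillation of `u` on `U` counts.
This is how bumps act as approximate identities below. -/
theorem IsBump.norm_integral_smul_sub_le {U : Set G} {e : G → ℝ} (he : IsBump μ U e)
    {E : Type*} [NormedAddCommGroup E] [NormedSpace ℂ E] [CompleteSpace E] {u : G → E}
    (hu : Continuous u) (v : E) {ε : ℝ} (h : ∀ y ∈ U, ‖u y - v‖ ≤ ε) :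
    ‖∫ y, (e y : ℂ) • u y ∂μ - v‖ ≤ ε := by
  have hec : Continuous fun y => (e y : ℂ) := Complex.continuous_ofReal.comp he.continuous
  have hcs : HasCompactSupport fun y => (e y : ℂ) :=
    he.hasCompactSupport.comp_left (g := fun r : ℝ => (r : ℂ)) Complex.ofReal_zero
  have hint : Integrable (fun y => (e y : ℂ) • u y) μ :=
    (hec.smul hu).integrable_of_hasCompactSupport hcs.smul_right
  have hint' : Integrable (fun y => (e y : ℂ) • v) μ :=
    (hec.smul continuous_const).integrable_of_hasCompactSupport hcs.smul_right
  have hv : v = ∫ y, (e y : ℂ) • v ∂μ := by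
    rw [integral_smul_const, integral_complex_ofReal, he.integral_eq_one, Complex.ofReal_one,
      one_smul]
  conv_lhs => rw [hv]
  rw [← integral_sub hint hint']
  have hei : Integrable e μ :=
    he.continuous.integrable_of_hasCompactSupport he.hasCompactSupport
  refine (norm_integral_le_of_norm_le (hei.mul_const ε) (Eventually.of_forall fun y => ?_)).trans
    (le_of_eq ?_)
  · rw [← smul_sub, norm_smul, Complex.norm_real, Real.norm_of_nonneg (he.nonneg y)]
    by_cases hy : y ∈ U
    · exact mul_le_mul_of_nonneg_left (h y hy) (he.nonneg y)
    · simp [he.eq_zero y hy]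
  · rw [integral_mul_const, he.integral_eq_one, one_mul]

namespace BeurlingAlgebra

variable {ω : GroupWeight G}

/-- The element of the Beurling algebra given by a bump function. -/
noncomputable def ofBump (ω : GroupWeight G) {U : Set G} {e : G → ℝ} (he : IsBump μ U e) :
    BeurlingAlgebra μ ω :=
  mk (fun x => (e x : ℂ)) (memLp_of_hasCompactSupport
    (Complex.continuous_ofReal.comp he.continuous)
    (he.hasCompactSupport.comp_left (g := fun r : ℝ => (r : ℂ)) Complex.ofReal_zero))

variable {U : Set G} {e : G → ℝ}

theorem coeFn_ofBump (he : IsBump μ U e) : ofBump ω he =ᵐ[μ] fun x => (e x : ℂ) :=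
  ac_weighted (coeFn_mk _ _)

/-- Bumps supported where `ω` is bounded are bounded in norm, which supplies the constant `K` in
Cohen's theorem. -/
theorem norm_ofBump_le (he : IsBump μ U e) {K : ℝ} (hK : ∀ y ∈ U, ω y ≤ K) :
    ‖ofBump ω he‖ ≤ K := by
  have hei : Integrable e μ :=
    he.continuous.integrable_of_hasCompactSupport he.hasCompactSupport
  rw [norm_eq]
  calc ∫ x, ‖ofBump ω he x‖ * ω x ∂μ ≤ ∫ x, e x * K ∂μ := by
        refine integral_mono_ae (integrable_norm_mul _) (hei.mul_const K) ?_
        filter_upwards [coeFn_ofBump (ω := ω) he] with x hx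
        rw [hx, Complex.norm_real, Real.norm_of_nonneg (he.nonneg x)]
        by_cases hy : x ∈ U
        · exact mul_le_mul_of_nonneg_left (hK x hy) (he.nonneg x)
        · simp [he.eq_zero x hy]
    _ = K := by rw [integral_mul_const, he.integral_eq_one, one_mul]

theorem ofBump_mul (he : IsBump μ U e) (g : BeurlingAlgebra μ ω) :
    ofBump ω he * g = ∫ y, (e y : ℂ) • translate y g ∂μ := by
  rw [mul_def]
  refine integral_congr_ae ?_
  filter_upwards [coeFn_ofBump (ω := ω) he] with x hx
  rw [hx]

variable {F : Type*} [NormedAddCommGroup F] [NormedSpace ℂ F] [CompleteSpace F]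

theorem map_mul_eq_integral (κ : BeurlingAlgebra μ ω →L[ℂ] F) (f g : BeurlingAlgebra μ ω) :
    κ (f * g) = ∫ y, f y • κ (translate y g) ∂μ := by
  rw [mul_def, ← κ.integral_comp_comm (integrable_conv f g)]
  simp only [map_smul]

theorem integrable_smul_of_le (f : BeurlingAlgebra μ ω) {Φ : G → F} (hΦ : Continuous Φ) {C : ℝ}
    (hC : ∀ y, ‖Φ y‖ ≤ C * ω y) : Integrable (fun y => f y • Φ y) μ := by
  refine ((integrable_norm_mul f).mul_const C).mono' (aestronglyMeasurable_smul f hΦ)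
    (Eventually.of_forall fun y => ?_)
  rw [norm_smul, mul_assoc, mul_comm (ω y)]
  exact mul_le_mul_of_nonneg_left (hC y) (norm_nonneg _)

theorem norm_integral_smul_le (f : BeurlingAlgebra μ ω) {Φ : G → F} {C : ℝ}
    (hC : ∀ y, ‖Φ y‖ ≤ C * ω y) : ‖∫ y, f y • Φ y ∂μ‖ ≤ C * ‖f‖ := by
  rw [norm_eq f, mul_comm, ← integral_mul_const]
  refine norm_integral_le_of_norm_le ((integrable_norm_mul f).mul_const C)
    (Eventually.of_forall fun y => ?_)
  rw [norm_smul, mul_assoc, mul_comm (ω y)]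
  exact mul_le_mul_of_nonneg_left (hC y) (norm_nonneg _)

/-- Integration against a continuous vector valued function dominated by the weight. -/
noncomputable def integralCLM {Φ : G → F} (hΦ : Continuous Φ) {C : ℝ}
    (hC : ∀ y, ‖Φ y‖ ≤ C * ω y) : BeurlingAlgebra μ ω →L[ℂ] F :=
  LinearMap.mkContinuous
    { toFun := fun f => ∫ y, f y • Φ y ∂μ
      map_add' := by
        intro f g
        rw [← integral_add (integrable_smul_of_le f hΦ hC) (integrable_smul_of_le g hΦ hC)]
        refine integral_congr_ae ?_
        filter_upwards [ac_weighted (coeFn_add f g)] with y hy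
        rw [hy, add_smul]
      map_smul' := by
        intro c f
        rw [RingHom.id_apply, ← integral_smul]
        refine integral_congr_ae ?_
        filter_upwards [ac_weighted (coeFn_smul c f)] with y hy
        rw [hy, mul_smul] }
    C (fun f => norm_integral_smul_le f hC)

theorem integralCLM_apply {Φ : G → F} (hΦ : Continuous Φ) {C : ℝ}
    (hC : ∀ y, ‖Φ y‖ ≤ C * ω y) (f : BeurlingAlgebra μ ω) :
    integralCLM hΦ hC f = ∫ y, f y • Φ y ∂μ := rfl

theorem integralCLM_translate_ofBump {Φ : G → F} (hΦ : Continuous Φ) {C : ℝ}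
    (hC : ∀ y, ‖Φ y‖ ≤ C * ω y) (he : IsBump μ U e) (y : G) :
    integralCLM hΦ hC (translate y (ofBump ω he)) = ∫ z, (e z : ℂ) • Φ (y * z) ∂μ := by
  rw [integralCLM_apply,
    ← integral_mul_left_eq_self (μ := μ) (fun s => (translate y (ofBump ω he)) s • Φ s) y]
  refine integral_congr_ae ?_
  filter_upwards [ac_weighted ((quasi_mul_left (μ := μ) (ω := ω) y).ae
    (coeFn_translate y (ofBump ω he))), coeFn_ofBump (ω := ω) he] with z hz hz'
  rw [hz, inv_mul_cancel_left, hz']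

theorem norm_translate_apply_le (Y : BeurlingAlgebra μ ω →L[ℂ] F) (y : G)
    (f : BeurlingAlgebra μ ω) : ‖Y (translate y f)‖ ≤ ‖Y‖ * ‖f‖ * ω y := by
  refine (Y.le_opNorm _).trans ?_
  rw [mul_assoc, mul_comm ‖f‖]
  exact mul_le_mul_of_nonneg_left (norm_translate_le y f) (norm_nonneg _)

/-- A vector valued function on `G` which is dominated by the weight and uniformly continuous
relative to it is a matrix coefficient of the translation action on the Beurling algebra. -/
theorem exists_apply_translate_eq (Φ : G → F) {C : ℝ} (hC : ∀ y, ‖Φ y‖ ≤ C * ω y)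
    (huc : ∀ ε > 0, ∀ᶠ z in 𝓝 (1 : G), ∀ y, ‖Φ (y * z) - Φ y‖ ≤ ε * ω y) :
    ∃ (a : BeurlingAlgebra μ ω) (Y : BeurlingAlgebra μ ω →L[ℂ] F),
      ∀ y, Y (translate y a) = Φ y := by
  have hΦ : Continuous Φ := by
    rw [continuous_iff_continuousAt]
    intro y
    rw [ContinuousAt, tendsto_iff_norm_sub_tendsto_zero, Metric.tendsto_nhds]
    intro ε hε
    have hy : Tendsto (fun x => y⁻¹ * x) (𝓝 y) (𝓝 1) := by
      have := (continuous_const_mul y⁻¹).tendsto y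
      rwa [inv_mul_cancel] at this
    filter_upwards [hy.eventually (huc (ε / (2 * ω y)) (by have := ω.pos y; positivity))] with x hx
    have h1 := hx y
    rw [mul_inv_cancel_left] at h1
    have hpos := ω.pos y
    have : ε / (2 * ω y) * ω y = ε / 2 := by field_simp
    rw [Real.dist_eq, sub_zero, abs_of_nonneg (norm_nonneg _)]
    linarith
  set κ : BeurlingAlgebra μ ω →L[ℂ] F := integralCLM hΦ hC with hκ
  have hωnhds : ∀ᶠ z in 𝓝 (1 : G), ω z ≤ ω 1 + 1 :=
    (ω.continuous_toFun.tendsto 1).eventually (eventually_le_nhds (by linarith))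
  -- `κ (translate y e)` averages `Φ` over `y W`; the error is measured relative to `ω y`, so that
  -- it can be integrated against any `f` in the algebra.
  have hbump : ∀ {W : Set G} {e : G → ℝ} (he : IsBump μ W e) {ε : ℝ},
      (∀ z ∈ W, ∀ y, ‖Φ (y * z) - Φ y‖ ≤ ε * ω y) → ∀ y,
      ‖κ (translate y (ofBump ω he)) - Φ y‖ ≤ ε * ω y := by
    intro W e he ε hW y
    rw [hκ, integralCLM_translate_ofBump]
    exact he.norm_integral_smul_sub_le (u := fun z => Φ (y * z))
      (hΦ.comp (continuous_const_mul y)) (Φ y) fun z hz => hW z hz y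
  have hmul : ∀ (b : BeurlingAlgebra μ ω) {ε : ℝ}, 0 < ε →
      ∀ᶠ z in 𝓝 (1 : G), ‖translate z b - b‖ ≤ ε := by
    intro b ε hε
    have h1 : translate (1 : G) b = b := by
      apply ext_ae
      filter_upwards [coeFn_translate 1 b] with x hx
      simp [hx]
    have h2 := (continuous_translate b).tendsto 1
    rw [h1, tendsto_iff_norm_sub_tendsto_zero] at h2
    exact h2.eventually (eventually_le_nhds hε)
  -- The algebra acts on operators by precomposition with right multiplication. Factoring `κ` as `ρ
  -- a Y` means `κ f = Y (f * a)`.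
  let ρ : BeurlingAlgebra μ ω →L[ℂ]
      ((BeurlingAlgebra μ ω →L[ℂ] F) →L[ℂ] (BeurlingAlgebra μ ω →L[ℂ] F)) :=
    (ContinuousLinearMap.compL ℂ (BeurlingAlgebra μ ω) (BeurlingAlgebra μ ω) F).flip ∘L
      (ContinuousLinearMap.mul ℂ (BeurlingAlgebra μ ω)).flip
  have hρ : ∀ e (T : BeurlingAlgebra μ ω →L[ℂ] F) f, ρ e T f = T (f * e) := fun e T f => rfl
  obtain ⟨a, Y, hY⟩ := cohen_factorization ρ
    (by intro a b; ext T f; simp only [hρ, mul_assoc, mul_apply_eq_comp])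
    κ (K := ω 1 + 1) (by
      intro ε hε b
      -- One neighbourhood serves three demands: bounded norm, near left unit for `b`, and near
      -- fixing of `κ`.
      obtain ⟨e, he⟩ := exists_isBump μ ((hωnhds.and (hmul b (half_pos hε))).and
        (huc (ε / 2) (half_pos hε)))
      refine ⟨ofBump ω he, norm_ofBump_le he fun y hy => hy.1.1, ?_, ?_⟩
      · rw [ofBump_mul]
        refine lt_of_le_of_lt (he.norm_integral_smul_sub_le (u := fun z => translate z b)
          (continuous_translate b) b fun y hy => hy.1.2) (half_lt_self hε)
      · refine lt_of_le_of_lt (ContinuousLinearMap.opNorm_le_bound _ (half_pos hε).le fun f => ?_)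
          (half_lt_self hε)
        rw [sub_apply, hρ, map_mul_eq_integral]
        have hc1 : Continuous fun y => κ (translate y (ofBump ω he)) :=
          κ.continuous.comp (continuous_translate _)
        have hκf : κ f = ∫ y, f y • Φ y ∂μ := rfl
        rw [hκf, ← integral_sub
          (integrable_smul_of_le f hc1 (norm_translate_apply_le κ · _))
          (integrable_smul_of_le f hΦ hC)]
        simp only [← smul_sub]
        exact norm_integral_smul_le f fun y => hbump he (fun z hz => hz.2) y)
  refine ⟨a, Y, fun y => ?_⟩
  -- Apply `κ f = Y (f * a)` to a translated bump: as the bump concentrates at `1`, the left side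
  -- tends to `Φ y` and the right side to `Y (translate y a)`.
  have key : ∀ ε > 0, ‖Y (translate y a) - Φ y‖ ≤ ε * (‖Y‖ * ω y + ω y) := by
    intro ε hε
    obtain ⟨e, he⟩ := exists_isBump μ ((hmul a hε).and (huc ε hε))
    have h1 : κ (translate y (ofBump ω he)) = Y (translate y (ofBump ω he * a)) := by
      rw [← hY, hρ]
      exact congrArg Y (translate_conv y _ _)
    have h2 : ‖ofBump ω he * a - a‖ ≤ ε := by
      rw [ofBump_mul]
      exact he.norm_integral_smul_sub_le (u := fun z => translate z a)
          (continuous_translate a) a fun y hy => hy.1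
    have h3 := hbump he (fun z hz => hz.2) y
    have h4 : ‖Y (translate y (a - ofBump ω he * a))‖ ≤ ε * (‖Y‖ * ω y) := by
      refine (norm_translate_apply_le _ _ _).trans ?_
      rw [norm_sub_rev]
      have := ω.pos y
      calc _ ≤ ‖Y‖ * ε * ω y := by gcongr
        _ = _ := by ring
    calc ‖Y (translate y a) - Φ y‖
        = ‖Y (translate y (a - ofBump ω he * a)) + (κ (translate y (ofBump ω he)) - Φ y)‖ := by
          rw [h1, map_sub, map_sub]; congr 1; abel
      _ ≤ _ := (norm_add_le _ _).trans (by rw [mul_add]; exact add_le_add h4 h3)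
  have hz : ‖Y (translate y a) - Φ y‖ ≤ 0 := by
    have ht : Tendsto (fun ε : ℝ => ε * (‖Y‖ * ω y + ω y)) (𝓝[>] 0) (𝓝 0) := by
      have : Tendsto (fun ε : ℝ => ε * (‖Y‖ * ω y + ω y)) (𝓝 0) (𝓝 (0 * (‖Y‖ * ω y + ω y))) :=
        (continuous_id.mul continuous_const).tendsto 0
      rw [zero_mul] at this
      exact this.mono_left nhdsWithin_le_nhds
    exact ge_of_tendsto ht (by filter_upwards [self_mem_nhdsWithin] with ε hε using key ε hε)
  exact sub_eq_zero.1 (norm_le_zero_iff.1 hz)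

end BeurlingAlgebra

end BeurlingFactorization

/-! ### Weights along powers and conjugates -/

namespace GroupWeight

variable {G : Type*} [Group G] [TopologicalSpace G] (ω : GroupWeight G)

theorem one_le_one : 1 ≤ ω 1 := by
  have h := ω.mul_le 1 1
  rw [mul_one] at h
  have := ω.pos 1
  nlinarith

theorem mul_pow_le (x y : G) (n : ℕ) : ω (x * y ^ n) ≤ ω x * ω y ^ n := by
  induction n with
  | zero => simp
  | succ n ih =>
    rw [pow_succ, ← mul_assoc, pow_succ, ← mul_assoc]
    exact (ω.mul_le _ _).trans (mul_le_mul_of_nonneg_right ih (ω.pos y).le)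

/-- Conjugation costs a factor independent of `n`, so it disappears from exponential growth rates.
-/
theorem conj_pow_le (u s : G) (n : ℕ) : ω ((u⁻¹ * s * u) ^ n) ≤ ω u⁻¹ * ω s ^ n * ω u := by
  have h : (u⁻¹ * s * u) ^ n = u⁻¹ * s ^ n * u := by
    simpa using (conj_pow (i := n) (a := u⁻¹) (b := s))
  rw [h]
  exact (ω.mul_le _ _).trans (mul_le_mul_of_nonneg_right (ω.mul_pow_le _ _ _) (ω.pos u).le)

/-- A weight is bounded below on a conjugate `s` of `g` by `(ω g⁻¹)⁻¹`. -/
theorem one_le_mul_inv_conj (u s : G) : 1 ≤ ω s * ω (u⁻¹ * s * u)⁻¹ := by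
  by_contra! hlt
  set g := u⁻¹ * s * u with hg
  have hr0 : 0 ≤ ω s * ω g⁻¹ := mul_nonneg (ω.pos _).le (ω.pos _).le
  -- Writing `1 = g^n g^{-n}` would keep a null geometric sequence, times a constant, above `1`.
  have hn : ∀ n : ℕ, 1 ≤ ω u⁻¹ * ω u * (ω s * ω g⁻¹) ^ n := by
    intro n
    calc 1 ≤ ω 1 := ω.one_le_one
      _ = ω (g ^ n * g⁻¹ ^ n) := by rw [inv_pow, mul_inv_cancel]
      _ ≤ ω (g ^ n) * ω g⁻¹ ^ n := ω.mul_pow_le _ _ _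
      _ ≤ (ω u⁻¹ * ω s ^ n * ω u) * ω g⁻¹ ^ n :=
        mul_le_mul_of_nonneg_right (ω.conj_pow_le u s n) (pow_nonneg (ω.pos _).le _)
      _ = _ := by rw [mul_pow]; ring
  have ht := (tendsto_pow_atTop_nhds_zero_of_lt_one hr0 hlt).const_mul (ω u⁻¹ * ω u)
  rw [mul_zero] at ht
  exact absurd (ge_of_tendsto' ht hn) (by norm_num)

variable [IsTopologicalGroup G] [LocallyCompactSpace G] [T2Space G]

open scoped Pointwise in
-- Off the compact set `tsupport ψ * L⁻¹` both values vanish for `z` in `L`. On it the strict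
-- inequality holds at `z = 1`, as `ω > 0`, and compactness makes it uniform in `y`.
theorem eventually_abs_mul_sub_le {ψ : G → ℝ} (hψ : Continuous ψ) (hc : HasCompactSupport ψ)
    {ε : ℝ} (hε : 0 < ε) : ∀ᶠ z in 𝓝 (1 : G), ∀ y, |ψ (y * z) - ψ y| ≤ ε * ω y := by
  obtain ⟨L, hL, hL1⟩ := exists_compact_mem_nhds (1 : G)
  have hK : IsCompact (tsupport ψ * L⁻¹) := IsCompact.mul hc hL.inv
  have hev : ∀ᶠ z in 𝓝 (1 : G), ∀ y ∈ tsupport ψ * L⁻¹, |ψ (y * z) - ψ y| < ε * ω y := by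
    refine hK.eventually_forall_of_forall_eventually
      (P := fun z y => |ψ (y * z) - ψ y| < ε * ω y) fun y _ => ?_
    have h1 : Continuous fun p : G × G => |ψ (p.2 * p.1) - ψ p.2| := by fun_prop
    have h2 : Continuous fun p : G × G => ε * ω p.2 :=
      continuous_const.mul (ω.continuous_toFun.comp continuous_snd)
    refine (isOpen_lt h1 h2).mem_nhds ?_
    simpa using mul_pos hε (ω.pos y)
  filter_upwards [hev, hL1] with z hz hzL y
  by_cases hy : y ∈ tsupport ψ * L⁻¹
  · exact (hz y hy).le
  · have aux : ∀ w ∈ L, ψ (y * w) = 0 := by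
      intro w hw
      by_contra hne
      exact hy ⟨y * w, subset_tsupport _ hne, w⁻¹, Set.inv_mem_inv.2 hw, by simp⟩
    have h1 := aux 1 (mem_of_mem_nhds hL1)
    rw [mul_one] at h1
    rw [aux z hzL, h1, sub_zero, abs_zero]
    exact mul_nonneg hε.le (ω.pos y).le

end GroupWeight

/-! ### One vector carrying all conjugates of a bump -/

section ConjugateCoefficients

variable {G : Type*} [Group G] [TopologicalSpace G] [IsTopologicalGroup G]
  [LocallyCompactSpace G] [T2Space G] [MeasurableSpace G] [BorelSpace G]
  {μ : Measure G} [μ.IsHaarMeasure] [μ.Regular] {ω : GroupWeight G}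

/-- All conjugates of one bump function along words are coefficients of a single vector, with
functionals growing at an arbitrarily slow exponential rate in the length of the word. -/
theorem BeurlingAlgebra.exists_conj_coefficients {ι : Type*} [Finite ι] (t : ι → G) {η : ℝ}
    (hη0 : 0 < η) (hη1 : η < 1) :
    ∃ (a : BeurlingAlgebra μ ω) (κ : List ι → (BeurlingAlgebra μ ω →L[ℂ] ℂ)) (C : ℝ) (k : G → ℂ),
      0 ≤ C ∧ k 1 = 1 ∧ (∀ w, ‖κ w‖ ≤ C * (η⁻¹) ^ w.length) ∧
      ∀ w y, κ w (translate y a) = k ((w.map t).prod⁻¹ * y * (w.map t).prod) := by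
  obtain ⟨k, hk, hkc, hk0, hk1, -, hkone⟩ := exists_continuous_one_at_one (G := G) univ_mem
  obtain ⟨B', hB'⟩ := (IsCompact.bddAbove_image hkc
    (ω.continuous_toFun.comp continuous_inv).continuousOn)
  set B := max B' 1 with hBdef
  have hB : ∀ g ∈ tsupport k, ω g⁻¹ ≤ B := fun g hg => (hB' ⟨g, hg, rfl⟩).trans (le_max_left _ _)
  have hB0 : 0 ≤ B := zero_le_one.trans (le_max_right _ _)
  -- Where `k` is nonzero the conjugate of `s` lies in a fixed compact set, so its inverse has
  -- bounded weight and `ω s` is bounded below independently of `u`.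
  have hbound : ∀ u s : G, k (u⁻¹ * s * u) ≤ B * ω s := by
    intro u s
    by_cases h : k (u⁻¹ * s * u) = 0
    · rw [h]; exact mul_nonneg hB0 (ω.pos s).le
    · have h1 := ω.one_le_mul_inv_conj u s
      have h2 := hB _ (subset_tsupport _ h)
      calc k (u⁻¹ * s * u) ≤ 1 := hk1 _
        _ ≤ ω s * ω (u⁻¹ * s * u)⁻¹ := h1
        _ ≤ ω s * B := mul_le_mul_of_nonneg_left h2 (ω.pos s).le
        _ = _ := mul_comm _ _
  set p : List ι → G := fun w => (w.map t).prod with hp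
  have hη : ∀ n : ℕ, η ^ n ≤ 1 := fun n => pow_le_one₀ hη0.le hη1.le
  have hcoord : ∀ y w, ‖((η ^ w.length * k ((p w)⁻¹ * y * p w) : ℝ) : ℂ)‖ ≤ B * ω y := by
    intro y w
    rw [Complex.norm_real, Real.norm_of_nonneg (mul_nonneg (pow_nonneg hη0.le _) (hk0 _))]
    exact (mul_le_of_le_one_left (hk0 _) (hη _)).trans (hbound _ _)
  -- All words are packed into one `ℓ^∞`-valued function, so that a single factorization gives a
  -- common `a`.
  let Φ : G → lp (fun _ : List ι => ℂ) ∞ := fun y =>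
    ⟨fun w => ((η ^ w.length * k ((p w)⁻¹ * y * p w) : ℝ) : ℂ),
      memℓp_infty ⟨B * ω y, by rintro _ ⟨w, rfl⟩; exact hcoord y w⟩⟩
  have hΦ : ∀ y w, Φ y w = ((η ^ w.length * k ((p w)⁻¹ * y * p w) : ℝ) : ℂ) := fun y w => rfl
  obtain ⟨a, Y, hY⟩ := BeurlingAlgebra.exists_apply_translate_eq (μ := μ) (ω := ω) Φ (C := B)
    (fun y => lp.norm_le_of_forall_le (mul_nonneg hB0 (ω.pos y).le) (hcoord y)) (by
      intro ε hε
      -- `B (ω 1 + 2) ω y` bounds the crude oscillation `B (ω (y z) + ω y)` once `ω z ≤ ω 1 + 1`.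
      -- Words of length at least `N` are then handled by damping alone, leaving finitely many short
      -- ones.
      have hM : 0 < B * (ω 1 + 2) := by
        have := ω.pos 1
        have : 1 ≤ B := le_max_right _ _
        positivity
      obtain ⟨N, hN⟩ := exists_pow_lt_of_lt_one (div_pos hε hM) hη1
      have hfin := List.finite_length_lt ι N
      have hsmall : ∀ᶠ z in 𝓝 (1 : G), ∀ w ∈ {l : List ι | l.length < N}, ∀ y,
          |k ((p w)⁻¹ * (y * z) * p w) - k ((p w)⁻¹ * y * p w)| ≤ ε * ω y := by
        refine (eventually_all_finite hfin).2 fun w _ => ?_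
        refine ω.eventually_abs_mul_sub_le (ψ := fun y => k ((p w)⁻¹ * y * p w)) (by fun_prop) ?_ hε
        exact HasCompactSupport.comp_homeomorph hkc
          ((Homeomorph.mulLeft (p w)⁻¹).trans (Homeomorph.mulRight (p w)))
      have hω : ∀ᶠ z in 𝓝 (1 : G), ω z ≤ ω 1 + 1 :=
        (ω.continuous_toFun.tendsto 1).eventually (eventually_le_nhds (by linarith))
      filter_upwards [hsmall, hω] with z hz hzω y
      refine lp.norm_le_of_forall_le (mul_nonneg hε.le (ω.pos y).le) fun w => ?_
      have heq : (Φ (y * z) - Φ y) w = ((η ^ w.length *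
          (k ((p w)⁻¹ * (y * z) * p w) - k ((p w)⁻¹ * y * p w)) : ℝ) : ℂ) := by
        rw [lp.coeFn_sub, Pi.sub_apply, hΦ, hΦ]
        push_cast
        ring
      rw [heq, Complex.norm_real, norm_mul, Real.norm_of_nonneg (pow_nonneg hη0.le _),
        Real.norm_eq_abs]
      by_cases hw : w.length < N
      · exact (mul_le_of_le_one_left (abs_nonneg _) (hη _)).trans (hz w hw y)
      · have h1 : |k ((p w)⁻¹ * (y * z) * p w) - k ((p w)⁻¹ * y * p w)|
            ≤ B * (ω 1 + 2) * ω y := by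
          have e1 := hbound (p w) (y * z)
          have e2 := hbound (p w) y
          have e3 := hk0 ((p w)⁻¹ * (y * z) * p w)
          have e4 := hk0 ((p w)⁻¹ * y * p w)
          have e5 : ω (y * z) ≤ ω y * (ω 1 + 1) :=
            (ω.mul_le y z).trans (mul_le_mul_of_nonneg_left hzω (ω.pos y).le)
          have e6 := mul_le_mul_of_nonneg_left e5 hB0
          have e7 : 0 ≤ B * ω y := mul_nonneg hB0 (ω.pos y).le
          have e8 : 0 ≤ B * (ω y * (ω 1 + 1)) :=
            mul_nonneg hB0 (mul_nonneg (ω.pos y).le (by have := ω.pos 1; linarith))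
          rw [abs_le]
          constructor <;> linarith
        have h2 : η ^ w.length ≤ ε / (B * (ω 1 + 2)) :=
          (pow_le_pow_of_le_one hη0.le hη1.le (not_lt.1 hw)).trans hN.le
        calc _ ≤ ε / (B * (ω 1 + 2)) * (B * (ω 1 + 2) * ω y) :=
              mul_le_mul h2 h1 (abs_nonneg _) (div_pos hε hM).le
          _ = ε * ω y := by rw [← mul_assoc, div_mul_cancel₀ _ hM.ne'])
  -- Undoing the damping of coordinate `w` is what costs `η⁻¹ ^ w.length` in norm.
  refine ⟨a, fun w => ((η⁻¹ ^ w.length : ℝ) : ℂ) • (lp.evalCLM ℂ (fun _ : List ι => ℂ) ∞ w ∘L Y),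
    ‖Y‖, fun g => (k g : ℂ), norm_nonneg _, by simp [hkone], fun w => ?_,
    fun w y => ?_⟩
  · refine ContinuousLinearMap.opNorm_le_bound _ (by positivity) fun f => ?_
    have h1 : ‖(Y f) w‖ ≤ ‖Y‖ * ‖f‖ :=
      (lp.norm_apply_le_norm ENNReal.top_ne_zero (Y f) w).trans (Y.le_opNorm f)
    have h2 : ((((η⁻¹ ^ w.length : ℝ) : ℂ) • (lp.evalCLM ℂ (fun _ : List ι => ℂ) ∞ w ∘L Y)) f)
      = ((η⁻¹ ^ w.length : ℝ) : ℂ) * (Y f) w := rfl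
    rw [h2, norm_mul, Complex.norm_real, Real.norm_of_nonneg (by positivity)]
    calc _ ≤ η⁻¹ ^ w.length * (‖Y‖ * ‖f‖) := mul_le_mul_of_nonneg_left h1 (by positivity)
      _ = _ := by ring
  · have h2 : ((((η⁻¹ ^ w.length : ℝ) : ℂ) • (lp.evalCLM ℂ (fun _ : List ι => ℂ) ∞ w ∘L Y))
        (translate y a)) = ((η⁻¹ ^ w.length : ℝ) : ℂ) * (Y (translate y a)) w := rfl
    rw [h2, hY, hΦ, ← Complex.ofReal_mul, ← mul_assoc, ← mul_pow, inv_mul_cancel₀ hη0.ne', one_pow,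
      one_mul]

end ConjugateCoefficients

/-! ### Bounded bilinear forms as functionals on the projective tensor product -/

section TensorForms

universe u

variable {A : Type u} [NonUnitalNormedRing A] [NormedSpace ℂ A] [IsScalarTower ℂ A A]
  [SMulCommClass ℂ A A]

namespace ProjTensor

theorem clm_ext {F : Type*} [NormedAddCommGroup F] [NormedSpace ℂ F]
    {S T : ProjTensor A →L[ℂ] F}
    (h : ∀ b c : A, S ((PiTensorProduct.tprod ℂ ![b, c] : ⨂[ℂ] _ : Fin 2, A) : ProjTensor A)
      = T ((PiTensorProduct.tprod ℂ ![b, c] : ⨂[ℂ] _ : Fin 2, A) : ProjTensor A)) : S = T := by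
  ext m
  induction m using UniformSpace.Completion.induction_on with
  | hp => exact isClosed_eq S.continuous T.continuous
  | ih m =>
    let ι : (⨂[ℂ] _ : Fin 2, A) →L[ℂ] ProjTensor A := UniformSpace.Completion.toComplL
    have hlin : (S ∘L ι).toLinearMap = (T ∘L ι).toLinearMap := by
      refine PiTensorProduct.ext (MultilinearMap.ext fun v => ?_)
      have hv : v = ![v 0, v 1] := by
        ext i; fin_cases i <;> rfl
      rw [hv]
      exact h (v 0) (v 1)
    exact congrArg (fun R : (⨂[ℂ] _ : Fin 2, A) →ₗ[ℂ] F => R m) hlin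

/-- The functional on `A ⊗^ A` induced by a bounded bilinear form. -/
noncomputable def lift (b : ContinuousMultilinearMap ℂ (fun _ : Fin 2 => A) ℂ) :
    ProjTensor A →L[ℂ] ℂ :=
  (PiTensorProduct.liftIsometry ℂ (fun _ : Fin 2 => A) ℂ b).fromCompletion

theorem lift_tmul (β : ContinuousMultilinearMap ℂ (fun _ : Fin 2 => A) ℂ) (b c : A) :
    lift β ((PiTensorProduct.tprod ℂ ![b, c] : ⨂[ℂ] _ : Fin 2, A) : ProjTensor A)
      = β ![b, c] := by
  rw [lift, ContinuousLinearMap.fromCompletion_apply_coe,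
    PiTensorProduct.liftIsometry_apply_apply, PiTensorProduct.lift.tprod]
  rfl

theorem norm_lift_le (β : ContinuousMultilinearMap ℂ (fun _ : Fin 2 => A) ℂ) {c : ℝ} (hc : 0 ≤ c)
    (h : ∀ f g, ‖β ![f, g]‖ ≤ c * (‖f‖ * ‖g‖)) (m : ProjTensor A) : ‖lift β m‖ ≤ c * ‖m‖ := by
  have hβ : ‖β‖ ≤ c := by
    refine ContinuousMultilinearMap.opNorm_le_bound hc fun v => ?_
    have hv : v = ![v 0, v 1] := by
      ext i; fin_cases i <;> rfl
    have := h (v 0) (v 1)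
    rw [← hv] at this
    simpa [Fin.prod_univ_two] using this
  induction m using UniformSpace.Completion.induction_on with
  | hp =>
    exact isClosed_le (lift β).continuous.norm (continuous_const.mul continuous_norm)
  | ih m =>
    rw [lift, ContinuousLinearMap.fromCompletion_apply_coe, UniformSpace.Completion.norm_coe]
    refine (ContinuousLinearMap.le_opNorm _ _).trans ?_
    rw [LinearIsometryEquiv.norm_map]
    exact mul_le_mul_of_nonneg_right hβ (norm_nonneg _)

/-- The bilinear form `(f, g) ↦ κ ((T f) g)`. -/
noncomputable def form (T : A →L[ℂ] A) (κ : A →L[ℂ] ℂ) :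
    ContinuousMultilinearMap ℂ (fun _ : Fin 2 => A) ℂ :=
  κ.compContinuousMultilinearMap
    ((mulBilin A).compContinuousLinearMap ![T, ContinuousLinearMap.id ℂ A])

theorem form_apply (T : A →L[ℂ] A) (κ : A →L[ℂ] ℂ) (f g : A) :
    form T κ ![f, g] = κ (T f * g) := by
  simp [form, mulBilin]

end ProjTensor

end TensorForms

/-! ### Multiplication operators on the Beurling algebra -/

section Multiplication

open scoped BoundedContinuousFunction

namespace BeurlingAlgebra

variable {G : Type*} [Group G] [TopologicalSpace G] [MeasurableSpace G] [BorelSpace G]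
  {μ : Measure G} {ω : GroupWeight G}

theorem memLp_bcf_mul (q : G →ᵇ ℝ) {f : G → ℂ} (hf : MemLp f 1 (weightedMeasure μ ω)) :
    MemLp (fun x => (q x : ℂ) * f x) 1 (weightedMeasure μ ω) := by
  refine hf.of_le_mul (c := ‖q‖) ((Complex.continuous_ofReal.comp
    q.continuous).measurable.aestronglyMeasurable.mul hf.1) (Eventually.of_forall fun x => ?_)
  rw [norm_mul, Complex.norm_real]
  exact mul_le_mul_of_nonneg_right (q.norm_coe_le_norm x) (norm_nonneg _)

theorem coeFn_mk_bcf_mul (q : G →ᵇ ℝ) (f : BeurlingAlgebra μ ω) :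
    mk _ (memLp_bcf_mul q (memLp f)) =ᵐ[μ] fun x => (q x : ℂ) * f x :=
  ac_weighted (coeFn_mk _ _)

/-- Pointwise multiplication by a bounded continuous function. -/
noncomputable def bcfMul (q : G →ᵇ ℝ) : BeurlingAlgebra μ ω →L[ℂ] BeurlingAlgebra μ ω :=
  LinearMap.mkContinuous
    { toFun := fun f => mk _ (memLp_bcf_mul q (memLp f))
      map_add' := by
        intro f g
        apply ext_ae
        filter_upwards [coeFn_mk _ (memLp_bcf_mul q (memLp (f + g))),
          coeFn_mk _ (memLp_bcf_mul q (memLp f)), coeFn_mk _ (memLp_bcf_mul q (memLp g)),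
          coeFn_add (mk _ (memLp_bcf_mul q (memLp f))) (mk _ (memLp_bcf_mul q (memLp g))),
          coeFn_add f g] with x h1 h2 h3 h4 h5
        rw [h1, h4, h2, h3, h5, mul_add]
      map_smul' := by
        intro c f
        apply ext_ae
        filter_upwards [coeFn_mk _ (memLp_bcf_mul q (memLp (c • f))),
          coeFn_mk _ (memLp_bcf_mul q (memLp f)),
          coeFn_smul c (mk _ (memLp_bcf_mul q (memLp f))), coeFn_smul c f] with x h1 h2 h3 h4
        rw [RingHom.id_apply, h1, h3, h2, h4, mul_left_comm] }
    ‖q‖ (by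
      intro f
      change ‖mk _ (memLp_bcf_mul q (memLp f))‖ ≤ _
      rw [norm_eq, norm_eq f, ← integral_const_mul]
      refine integral_mono_ae (integrable_norm_mul _) ((integrable_norm_mul f).const_mul _) ?_
      filter_upwards [coeFn_mk_bcf_mul q f] with x hx
      rw [hx, norm_mul, Complex.norm_real, mul_assoc]
      exact mul_le_mul_of_nonneg_right (q.norm_coe_le_norm x)
        (mul_nonneg (norm_nonneg _) (ω.pos x).le))

theorem coeFn_bcfMul (q : G →ᵇ ℝ) (f : BeurlingAlgebra μ ω) :
    bcfMul q f =ᵐ[μ] fun x => (q x : ℂ) * f x := coeFn_mk_bcf_mul q f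

/-- `L¹` norms of nonnegative multiples add exactly, so only the pointwise sum matters and the
number of terms, here exponential in the word length, does not. -/
theorem sum_norm_bcfMul_le {ι : Type*} (s : Finset ι) (q : ι → G →ᵇ ℝ) (hq : ∀ i x, 0 ≤ q i x)
    {c : ℝ} (hc : ∀ x, ∑ i ∈ s, q i x ≤ c) (f : BeurlingAlgebra μ ω) :
    ∑ i ∈ s, ‖bcfMul (q i) f‖ ≤ c * ‖f‖ := by
  have h1 : ∀ i, ‖bcfMul (q i) f‖ = ∫ x, q i x * (‖f x‖ * ω x) ∂μ := by
    intro i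
    rw [norm_eq]
    refine integral_congr_ae ?_
    filter_upwards [coeFn_bcfMul (q i) f] with x hx
    rw [hx, norm_mul, Complex.norm_real, Real.norm_of_nonneg (hq i x), mul_assoc]
  have hint : ∀ i, Integrable (fun x => q i x * (‖f x‖ * ω x)) μ := fun i =>
    (integrable_norm_mul f).bdd_mul (c := ‖q i‖) (q i).continuous.measurable.aestronglyMeasurable
      (Eventually.of_forall (q i).norm_coe_le_norm)
  simp only [h1]
  rw [← integral_finsetSum s fun i _ => hint i, norm_eq f, ← integral_const_mul]
  refine integral_mono (integrable_finsetSum s fun i _ => hint i)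
    ((integrable_norm_mul f).const_mul _) fun x => ?_
  simp only [← Finset.sum_mul]
  exact mul_le_mul_of_nonneg_right (hc x) (mul_nonneg (norm_nonneg _) (ω.pos x).le)

end BeurlingAlgebra

end Multiplication

/-! ### Words and the weights of the Markov transition -/

section Words

/-- The finite set of words of length `n`. -/
def words (ι : Type*) [Fintype ι] : ℕ → Finset (List ι)
  | 0 => {[]}
  | n + 1 => ((Finset.univ : Finset ι) ×ˢ words ι n).map
      ⟨fun p => p.1 :: p.2, fun _ _ h => Prod.ext (List.cons.inj h).1 (List.cons.inj h).2⟩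

variable {ι : Type*} [Fintype ι]

theorem sum_words_succ {M : Type*} [AddCommMonoid M] (n : ℕ) (F : List ι → M) :
    ∑ w ∈ words ι (n + 1), F w = ∑ j, ∑ w ∈ words ι n, F (j :: w) := by
  rw [words, Finset.sum_map, Finset.sum_product]
  rfl

theorem length_of_mem_words {n : ℕ} {w : List ι} (hw : w ∈ words ι n) : w.length = n := by
  induction n generalizing w with
  | zero => simpa [words] using hw
  | succ n ih =>
    simp only [words, Finset.mem_map, Finset.mem_product, Finset.mem_univ, true_and,
      Prod.exists] at hw
    obtain ⟨j, w, hw, rfl⟩ := hw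
    exact congrArg (· + 1) (ih hw)

end Words

section Flow

open scoped BoundedContinuousFunction

variable {G : Type*} [Group G] [TopologicalSpace G] [IsTopologicalGroup G]

/-- The mass carried along a word by the Markov transition in which the point `x` moves to `t j * x`
with probability `q j x`. -/
noncomputable def flowWeight {ι : Type*} (t : ι → G) (q : ι → G →ᵇ ℝ) : List ι → (G →ᵇ ℝ)
  | [] => 1
  | j :: w => (q j * flowWeight t q w).compContinuous ⟨fun x => (t j)⁻¹ * x, by fun_prop⟩

variable {ι : Type*} {t : ι → G} {q : ι → G →ᵇ ℝ}

theorem flowWeight_cons_apply (j : ι) (w : List ι) (x : G) :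
    flowWeight t q (j :: w) x = q j ((t j)⁻¹ * x) * flowWeight t q w ((t j)⁻¹ * x) := rfl

theorem flowWeight_nonneg (hq : ∀ j x, 0 ≤ q j x) (w : List ι) (x : G) :
    0 ≤ flowWeight t q w x := by
  induction w generalizing x with
  | nil => simp [flowWeight]
  | cons j w ih => exact mul_nonneg (hq _ _) (ih _)

/-- The density `1` is dominated by `v`, and each step of the transition contracts `v` by `θ`. -/
theorem sum_flowWeight_le [Fintype ι] (hq : ∀ j x, 0 ≤ q j x) {v : G → ℝ} (hv : ∀ x, 1 ≤ v x)
    {θ : ℝ} (hθ : 0 ≤ θ) (hflow : ∀ x, ∑ j, q j ((t j)⁻¹ * x) * v ((t j)⁻¹ * x) ≤ θ * v x)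
    (n : ℕ) (x : G) : ∑ w ∈ words ι n, flowWeight t q w x ≤ θ ^ n * v x := by
  induction n generalizing x with
  | zero => simpa [words, flowWeight] using hv x
  | succ n ih =>
    rw [sum_words_succ]
    calc ∑ j, ∑ w ∈ words ι n, flowWeight t q (j :: w) x
        = ∑ j, q j ((t j)⁻¹ * x) * ∑ w ∈ words ι n, flowWeight t q w ((t j)⁻¹ * x) := by
          simp only [flowWeight_cons_apply, Finset.mul_sum]
      _ ≤ ∑ j, q j ((t j)⁻¹ * x) * (θ ^ n * v ((t j)⁻¹ * x)) :=
          Finset.sum_le_sum fun j _ => mul_le_mul_of_nonneg_left (ih _) (hq _ _)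
      _ = θ ^ n * ∑ j, q j ((t j)⁻¹ * x) * v ((t j)⁻¹ * x) := by
          rw [Finset.mul_sum]
          exact Finset.sum_congr rfl fun j _ => by ring
      _ ≤ θ ^ n * (θ * v x) := mul_le_mul_of_nonneg_left (hflow x) (pow_nonneg hθ n)
      _ = _ := by ring

end Flow

/-! ### A contracting flow rules out pseudo-amenability -/

namespace BeurlingAlgebra

open scoped BoundedContinuousFunction

variable {G : Type*} [Group G] [TopologicalSpace G] [IsTopologicalGroup G]
  [LocallyCompactSpace G] [T2Space G] [MeasurableSpace G] [BorelSpace G]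
  {μ : Measure G} [μ.IsHaarMeasure] [μ.Regular] {ω : GroupWeight G}
  {ι : Type*} {t : ι → G} {q : ι → G →ᵇ ℝ}

theorem translate_one (f : BeurlingAlgebra μ ω) : translate (1 : G) f = f := by
  apply ext_ae
  filter_upwards [coeFn_translate 1 f] with x hx
  simp [hx]

theorem translate_mul (y : G) (f g : BeurlingAlgebra μ ω) :
    translate y (f * g) = translate y f * g := (translate_conv y f g).symm

theorem bcfMul_one (f : BeurlingAlgebra μ ω) : bcfMul 1 f = f := by
  apply ext_ae
  filter_upwards [weighted_ac (coeFn_bcfMul 1 f)] with x hx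
  simp [hx]

theorem sum_bcfMul_eq [Fintype ι] (hq : ∀ x, ∑ j, q j x = 1) (f : BeurlingAlgebra μ ω) :
    ∑ j, bcfMul (q j) f = f := by
  have h : ∀ s : Finset ι, ∑ j ∈ s, bcfMul (q j) f = bcfMul (∑ j ∈ s, q j) f := by
    classical
    intro s
    induction s using Finset.induction_on with
    | empty =>
      apply ext_ae
      filter_upwards [weighted_ac (coeFn_bcfMul 0 f),
        Lp.coeFn_zero ℂ 1 (weightedMeasure μ ω)] with x h1 h2
      rw [Finset.sum_empty, Finset.sum_empty, h1]
      exact Eq.trans h2 (by simp)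
    | insert i s hi ih =>
      rw [Finset.sum_insert hi, Finset.sum_insert hi, ih]
      apply ext_ae
      filter_upwards [coeFn_add (bcfMul (q i) f) (bcfMul (∑ j ∈ s, q j) f),
        weighted_ac (coeFn_bcfMul (q i) f), weighted_ac (coeFn_bcfMul (∑ j ∈ s, q j) f),
        weighted_ac (coeFn_bcfMul (q i + ∑ j ∈ s, q j) f)] with x h1 h2 h3 h4
      rw [h1, h2, h3, h4, BoundedContinuousFunction.add_apply]
      push_cast
      ring
  rw [h]
  have h1 : ∑ j, q j = 1 := by
    ext x
    simpa using hq x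
  rw [h1, bcfMul_one]

/-- Peeling off the first letter conjugates the shorter multiplier by a translation; this is the
recursion linking lengths `n + 1` and `n`. -/
theorem bcfMul_flowWeight_cons (j : ι) (w : List ι) (f : BeurlingAlgebra μ ω) :
    bcfMul (flowWeight t q (j :: w)) f
      = translate (t j) (bcfMul (q j) (bcfMul (flowWeight t q w) (translate (t j)⁻¹ f))) := by
  set g := translate (t j)⁻¹ f with hg
  set g' := bcfMul (flowWeight t q w) g with hg'
  apply ext_ae
  have hac : ∀ {P : G → Prop}, (∀ᵐ x ∂μ, P x) → ∀ᵐ x ∂(weightedMeasure μ ω), P ((t j)⁻¹ * x) :=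
    fun hP => (quasi_mul_left (μ := μ) (ω := ω) (t j)⁻¹).ae (weighted_ac.ae_le hP)
  filter_upwards [weighted_ac (coeFn_bcfMul (flowWeight t q (j :: w)) f),
    coeFn_translate (t j) (bcfMul (q j) g'), hac (coeFn_bcfMul (q j) g'),
    hac (coeFn_bcfMul (flowWeight t q w) g),
    hac (ac_weighted (coeFn_translate (t j)⁻¹ f))] with x h1 h2 h3 h4 h5
  rw [h1, h2, h3, h4, h5, flowWeight_cons_apply]
  simp [mul_assoc]

variable [Fintype ι]

/-- The functional `f ⊗ g ↦ ∑ κ w ((S (Q w · P f)) g)` on the projective tensor product, the sum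
being over the words of length `n` with flow weights `Q w`. -/
noncomputable def flowForm (t : ι → G) (q : ι → G →ᵇ ℝ) (n : ℕ)
    (S P : BeurlingAlgebra μ ω →L[ℂ] BeurlingAlgebra μ ω)
    (κ : List ι → (BeurlingAlgebra μ ω →L[ℂ] ℂ)) : ProjTensor (BeurlingAlgebra μ ω) →L[ℂ] ℂ :=
  ProjTensor.lift (∑ w ∈ words ι n, ProjTensor.form (S ∘L bcfMul (flowWeight t q w) ∘L P) (κ w))

theorem flowForm_tmul (n : ℕ) (S P : BeurlingAlgebra μ ω →L[ℂ] BeurlingAlgebra μ ω)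
    (κ : List ι → (BeurlingAlgebra μ ω →L[ℂ] ℂ)) (f g : BeurlingAlgebra μ ω) :
    flowForm t q n S P κ ((PiTensorProduct.tprod ℂ ![f, g] :
        ⨂[ℂ] _ : Fin 2, BeurlingAlgebra μ ω) : ProjTensor (BeurlingAlgebra μ ω))
      = ∑ w ∈ words ι n, κ w (S (bcfMul (flowWeight t q w) (P f)) * g) := by
  rw [flowForm, ProjTensor.lift_tmul, sum_apply]
  simp only [ProjTensor.form_apply, ContinuousLinearMap.comp_apply]

/-- The growth `η⁻¹ ^ n` of the functionals competes with the decay `θ ^ n` of the total weight; the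
constants from `S` and `P` do not depend on `n`. -/
theorem norm_flowForm_le (hq : ∀ j x, 0 ≤ q j x) {θ η V C : ℝ} (hθ : 0 ≤ θ) (hη : 0 < η)
    (hV : 0 ≤ V) (hC : 0 ≤ C)
    (hsum : ∀ n x, ∑ w ∈ words ι n, flowWeight t q w x ≤ θ ^ n * V) (n : ℕ)
    (S P : BeurlingAlgebra μ ω →L[ℂ] BeurlingAlgebra μ ω)
    {κ : List ι → (BeurlingAlgebra μ ω →L[ℂ] ℂ)} (hκ : ∀ w, ‖κ w‖ ≤ C * η⁻¹ ^ w.length)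
    (m : ProjTensor (BeurlingAlgebra μ ω)) :
    ‖flowForm t q n S P κ m‖ ≤ C * ‖S‖ * ‖P‖ * V * (η⁻¹ * θ) ^ n * ‖m‖ := by
  refine ProjTensor.norm_lift_le _ (by positivity) (fun f g => ?_) m
  rw [sum_apply]
  calc ‖∑ w ∈ words ι n, ProjTensor.form (S ∘L bcfMul (flowWeight t q w) ∘L P) (κ w) ![f, g]‖
      ≤ ∑ w ∈ words ι n,
          C * η⁻¹ ^ n * (‖S‖ * ‖bcfMul (flowWeight t q w) (P f)‖ * ‖g‖) := by
        refine norm_sum_le_of_le _ fun w hw => ?_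
        rw [ProjTensor.form_apply]
        refine ((κ w).le_opNorm _).trans ?_
        have h1 := hκ w
        rw [length_of_mem_words hw] at h1
        refine mul_le_mul h1 ?_ (norm_nonneg _) (by positivity)
        refine (norm_mul_le _ _).trans ?_
        exact mul_le_mul_of_nonneg_right (S.le_opNorm _) (norm_nonneg _)
    _ = C * η⁻¹ ^ n * ‖S‖ * ‖g‖ * ∑ w ∈ words ι n, ‖bcfMul (flowWeight t q w) (P f)‖ := by
        rw [Finset.mul_sum]
        exact Finset.sum_congr rfl fun w _ => by ring
    _ ≤ C * η⁻¹ ^ n * ‖S‖ * ‖g‖ * (θ ^ n * V * (‖P‖ * ‖f‖)) := by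
        refine mul_le_mul_of_nonneg_left ?_ (by positivity)
        refine (sum_norm_bcfMul_le _ _ (flowWeight_nonneg hq) (hsum n) _).trans ?_
        exact mul_le_mul_of_nonneg_left (P.le_opNorm f) (by positivity)
    _ = _ := by rw [mul_pow]; ring

/-- A flow along which Haar measure is contracted at an exponential rate prevents the Beurling
algebra from being pseudo-amenable. -/
theorem not_pseudoAmenable_of_flow (t : ι → G) (q : ι → G →ᵇ ℝ) (hq : ∀ j x, 0 ≤ q j x)
    (hq1 : ∀ x, ∑ j, q j x = 1) {v : G → ℝ} {V θ : ℝ} (hv : ∀ x, 1 ≤ v x) (hvV : ∀ x, v x ≤ V)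
    (hθ0 : 0 ≤ θ) (hθ1 : θ < 1)
    (hflow : ∀ x, ∑ j, q j ((t j)⁻¹ * x) * v ((t j)⁻¹ * x) ≤ θ * v x) :
    ¬ PseudoAmenable (BeurlingAlgebra μ ω) := by
  rintro ⟨I, _, _, _, m, hm⟩
  -- Taking `η > θ` makes the ratio `r = η⁻¹ * θ` less than `1`.
  obtain ⟨η, hθη, hη1⟩ := exists_between hθ1
  have hη0 : 0 < η := hθ0.trans_lt hθη
  obtain ⟨a, κ, C, k, hC, hk1, hκ, hκa⟩ :=
    exists_conj_coefficients (μ := μ) (ω := ω) t hη0 hη1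
  set Ra : BeurlingAlgebra μ ω →L[ℂ] BeurlingAlgebra μ ω :=
    (ContinuousLinearMap.mul ℂ (BeurlingAlgebra μ ω)).flip a with hRa
  have hRa' : ∀ f, Ra f = f * a := fun f => rfl
  have hκRa : ∀ w, ‖κ w ∘L Ra‖ ≤ C * ‖Ra‖ * η⁻¹ ^ w.length := fun w => by
    refine ((κ w).opNorm_comp_le Ra).trans ?_
    calc ‖κ w‖ * ‖Ra‖ ≤ C * η⁻¹ ^ w.length * ‖Ra‖ :=
          mul_le_mul_of_nonneg_right (hκ w) (norm_nonneg _)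
      _ = _ := by ring
  have hV : 0 ≤ V := zero_le_one.trans ((hv 1).trans (hvV 1))
  have hsum : ∀ n x, ∑ w ∈ words ι n, flowWeight t q w x ≤ θ ^ n * V := fun n x =>
    (sum_flowWeight_le hq hv hθ0 hflow n x).trans
      (mul_le_mul_of_nonneg_left (hvV x) (pow_nonneg hθ0 n))
  set r := η⁻¹ * θ with hr
  have hr0 : 0 ≤ r := by positivity
  have hr1 : r < 1 := by
    rw [hr, inv_mul_lt_iff₀ hη0, mul_one]
    exact hθη
  set I₀ := ContinuousLinearMap.id ℂ (BeurlingAlgebra μ ω) with hI₀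
  -- conjugation of the coefficient functionals
  have hconj : ∀ j w f, κ (j :: w) (f * a)
      = κ w (translate (t j)⁻¹ (f * translate (t j) a)) := by
    intro j w f
    have h1 := map_mul_eq_integral (κ w ∘L translate (t j)⁻¹) f (translate (t j) a)
    rw [ContinuousLinearMap.comp_apply] at h1
    rw [h1, map_mul_eq_integral]
    congr 1
    ext y
    rw [ContinuousLinearMap.comp_apply, translate_translate, translate_translate, hκa, hκa,
      List.map_cons, List.prod_cons]
    congr 2
    group
  set B : ℕ → (ProjTensor (BeurlingAlgebra μ ω) →L[ℂ] ℂ) := fun n =>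
    flowForm t q n I₀ I₀ (fun w => κ w ∘L Ra) with hB
  set D : ℕ → ι → (ProjTensor (BeurlingAlgebra μ ω) →L[ℂ] ℂ) := fun n j =>
    flowForm t q n (bcfMul (q j)) I₀ κ with hD
  set D' : ℕ → ι → (ProjTensor (BeurlingAlgebra μ ω) →L[ℂ] ℂ) := fun n j =>
    flowForm t q n (bcfMul (q j)) (translate (t j)⁻¹) κ with hD'
  have hBsucc : ∀ n M, B (n + 1) M
      = ∑ j, D' n j (ProjTensor.rightAct (translate (t j) a) M) := by
    intro n M
    have : B (n + 1) = ∑ j, D' n j ∘L ProjTensor.rightAct (translate (t j) a) := by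
      refine ProjTensor.clm_ext fun f g => ?_
      simp only [hB, hD', sum_apply, ContinuousLinearMap.comp_apply,
        ProjTensor.rightAct_tmul, flowForm_tmul, sum_words_succ]
      refine Finset.sum_congr rfl fun j _ => Finset.sum_congr rfl fun w _ => ?_
      rw [hRa', bcfMul_flowWeight_cons]
      simp only [hI₀, ContinuousLinearMap.id_apply]
      rw [hconj, translate_mul, translate_mul, translate_translate, inv_mul_cancel, translate_one,
        mul_assoc]
    rw [this]
    simp only [sum_apply, ContinuousLinearMap.comp_apply]
  -- Since the `q j` sum to `1`, inserting them changes nothing and puts `B n` in the same shape as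
  -- the recursion for `B (n + 1)`.
  have hBeq : ∀ n M, B n M = ∑ j, D n j (ProjTensor.rightAct a M) := by
    intro n M
    have : B n = ∑ j, D n j ∘L ProjTensor.rightAct a := by
      refine ProjTensor.clm_ext fun f g => ?_
      simp only [hB, hD, sum_apply, ContinuousLinearMap.comp_apply,
        ProjTensor.rightAct_tmul, flowForm_tmul]
      rw [Finset.sum_comm]
      refine Finset.sum_congr rfl fun w _ => ?_
      simp only [hI₀, ContinuousLinearMap.id_apply, hRa']
      rw [← map_sum, ← Finset.sum_mul, sum_bcfMul_eq hq1, mul_assoc]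
    rw [this]
    simp only [sum_apply, ContinuousLinearMap.comp_apply]
  -- With `a` on the left instead of the right the two families agree, since the translations by `t
  -- j` and its inverse cancel. Hence `B (n + 1) - B n` sees only commutators.
  have hDD' : ∀ n j M, D' n j (ProjTensor.leftAct (translate (t j) a) M)
      = D n j (ProjTensor.leftAct a M) := by
    intro n j M
    have : D' n j ∘L ProjTensor.leftAct (translate (t j) a) = D n j ∘L ProjTensor.leftAct a := by
      refine ProjTensor.clm_ext fun f g => ?_
      simp only [hD, hD', ContinuousLinearMap.comp_apply, ProjTensor.leftAct_tmul, flowForm_tmul]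
      refine Finset.sum_congr rfl fun w _ => ?_
      rw [translate_mul, translate_translate, inv_mul_cancel, translate_one]
      rfl
    exact congrArg (fun R : ProjTensor (BeurlingAlgebra μ ω) →L[ℂ] ℂ => R M) this
  set c : ι → ProjTensor (BeurlingAlgebra μ ω) → ℝ := fun j M =>
    ‖ProjTensor.leftAct (translate (t j) a) M - ProjTensor.rightAct (translate (t j) a) M‖ with hc
  set c₀ : ProjTensor (BeurlingAlgebra μ ω) → ℝ := fun M =>
    ‖ProjTensor.leftAct a M - ProjTensor.rightAct a M‖ with hc₀
  set err : ProjTensor (BeurlingAlgebra μ ω) → ℝ := fun M =>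
    ∑ j, (C * ‖(bcfMul (q j) : BeurlingAlgebra μ ω →L[ℂ] _)‖ *
        ‖(translate (t j)⁻¹ : BeurlingAlgebra μ ω →L[ℂ] _)‖ * V * c j M +
      C * ‖(bcfMul (q j) : BeurlingAlgebra μ ω →L[ℂ] _)‖ * ‖I₀‖ * V * c₀ M) with herr
  have hstep : ∀ n M, ‖B (n + 1) M - B n M‖ ≤ r ^ n * err M := by
    intro n M
    have e1 : B (n + 1) M - B n M = ∑ j,
        (D n j (ProjTensor.leftAct a M - ProjTensor.rightAct a M) -
          D' n j (ProjTensor.leftAct (translate (t j) a) M -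
            ProjTensor.rightAct (translate (t j) a) M)) := by
      rw [hBsucc, hBeq, ← Finset.sum_sub_distrib]
      refine Finset.sum_congr rfl fun j _ => ?_
      rw [map_sub, map_sub, hDD']
      abel
    rw [e1, herr, Finset.mul_sum]
    refine norm_sum_le_of_le _ fun j _ => ?_
    refine (norm_sub_le _ _).trans ?_
    have e2 := norm_flowForm_le (t := t) hq hθ0 hη0 hV hC hsum n (bcfMul (q j)) I₀ hκ
      (ProjTensor.leftAct a M - ProjTensor.rightAct a M)
    have e3 := norm_flowForm_le (t := t) hq hθ0 hη0 hV hC hsum n (bcfMul (q j))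
      (translate (t j)⁻¹) hκ (ProjTensor.leftAct (translate (t j) a) M -
        ProjTensor.rightAct (translate (t j) a) M)
    refine (add_le_add e2 e3).trans (le_of_eq ?_)
    simp only [hc, hc₀, hr]
    ring
  have herr0 : ∀ M, 0 ≤ err M := fun M => by
    simp only [herr, hc, hc₀]
    positivity
  have hB0 : ∀ M, ‖B 0 M‖ ≤ (1 - r)⁻¹ * err M := by
    intro M
    have hpart : ∀ N, ‖B N M - B 0 M‖ ≤ (∑ n ∈ Finset.range N, r ^ n) * err M := by
      intro N
      rw [← Finset.sum_range_sub (fun n => B n M), Finset.sum_mul]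
      exact norm_sum_le_of_le _ fun n _ => hstep n M
    -- The limit is taken with `M` fixed, so the factor `‖M‖` is absent from the final estimate and
    -- unbounded nets are allowed.
    have hlim : Tendsto (fun N => B N M) atTop (𝓝 0) := by
      have hz := ((tendsto_pow_atTop_nhds_zero_of_lt_one hr0 hr1).const_mul
        (C * ‖Ra‖ * ‖I₀‖ * ‖I₀‖ * V)).mul_const ‖M‖
      rw [mul_zero, zero_mul] at hz
      exact squeeze_zero_norm (fun N => norm_flowForm_le (t := t) hq hθ0 hη0 hV (by positivity)
        hsum N I₀ I₀ hκRa M) hz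
    have hlim2 := (hlim.sub_const (B 0 M)).norm
    rw [zero_sub, norm_neg] at hlim2
    refine le_of_tendsto' hlim2 fun N => (hpart N).trans ?_
    refine mul_le_mul_of_nonneg_right ?_ (herr0 M)
    rw [← tsum_geometric_of_lt_one hr0 hr1]
    exact (summable_geometric_of_lt_one hr0 hr1).sum_le_tsum _ fun n _ => pow_nonneg hr0 n
  have hB0eq : ∀ M, B 0 M = κ [] (ProjTensor.prodMap _ (ProjTensor.rightAct a M)) := by
    intro M
    have : B 0 = κ [] ∘L ProjTensor.prodMap _ ∘L ProjTensor.rightAct a := by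
      refine ProjTensor.clm_ext fun f g => ?_
      simp only [hB, ContinuousLinearMap.comp_apply, ProjTensor.rightAct_tmul, flowForm_tmul,
        ProjTensor.prodMap_tmul, words, Finset.sum_singleton, flowWeight, bcfMul_one, hI₀,
        ContinuousLinearMap.id_apply, hRa', mul_assoc]
    rw [this]
    rfl
  have hleft : ∀ M, ProjTensor.prodMap _ (ProjTensor.leftAct a M) = a * ProjTensor.prodMap _ M := by
    intro M
    have : ProjTensor.prodMap _ ∘L ProjTensor.leftAct a
        = ContinuousLinearMap.mul ℂ (BeurlingAlgebra μ ω) a ∘L ProjTensor.prodMap _ := by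
      refine ProjTensor.clm_ext fun f g => ?_
      simp only [ContinuousLinearMap.comp_apply, ProjTensor.leftAct_tmul, ProjTensor.prodMap_tmul,
        ContinuousLinearMap.mul_apply', mul_assoc]
    exact congrArg (fun R : ProjTensor (BeurlingAlgebra μ ω) →L[ℂ] BeurlingAlgebra μ ω => R M) this
  -- Trading `M · a` for `a · M` up to a null commutator turns `π(m_i · a)` into `a π(m_i)`, which
  -- tends to `a`.
  have hlim1 : Tendsto (fun i => B 0 (m i)) atTop (𝓝 1) := by
    have h1 := ((ProjTensor.prodMap (BeurlingAlgebra μ ω)).continuous.tendsto 0).comp (hm a).1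
    have h2 := (hm a).2.sub h1
    rw [map_zero, sub_zero] at h2
    have h3 := ((κ []).continuous.tendsto a).comp h2
    have h4 : κ [] a = 1 := by
      have := hκa [] 1
      rw [translate_one] at this
      simpa [hk1] using this
    rw [h4] at h3
    refine h3.congr fun i => ?_
    simp only [Function.comp_apply]
    rw [hB0eq, map_sub (ProjTensor.prodMap _), hleft, sub_sub_cancel]
  have hlim0 : Tendsto (fun i => B 0 (m i)) atTop (𝓝 0) := by
    have h0 : Tendsto (fun i => c₀ (m i)) atTop (𝓝 0) := by simpa [hc₀] using (hm a).1.norm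
    have hj : ∀ j, Tendsto (fun i => c j (m i)) atTop (𝓝 0) := fun j => by
      simpa [hc] using (hm (translate (t j) a)).1.norm
    have he : Tendsto (fun i => err (m i)) atTop (𝓝 0) := by
      have := tendsto_finsetSum (Finset.univ : Finset ι) fun j _ =>
        ((hj j).const_mul (C * ‖(bcfMul (q j) : BeurlingAlgebra μ ω →L[ℂ] _)‖ *
          ‖(translate (t j)⁻¹ : BeurlingAlgebra μ ω →L[ℂ] _)‖ * V)).add
        (h0.const_mul (C * ‖(bcfMul (q j) : BeurlingAlgebra μ ω →L[ℂ] _)‖ * ‖I₀‖ * V))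
      simpa using this
    have := he.const_mul (1 - r)⁻¹
    rw [mul_zero] at this
    exact squeeze_zero_norm (fun i => hB0 (m i)) this
  exact one_ne_zero (tendsto_nhds_unique hlim1 hlim0)

end BeurlingAlgebra

/-! ### Invariant means, contracting flows and characters -/

section InvariantMean

open scoped BoundedContinuousFunction

variable {G : Type*} [Group G] [TopologicalSpace G] [IsTopologicalGroup G]

/-- Left translation of bounded continuous functions. -/
def leftShift (h : G) (F : G →ᵇ ℝ) : G →ᵇ ℝ := F.compContinuous ⟨fun x => h * x, by fun_prop⟩

theorem leftShift_apply (h : G) (F : G →ᵇ ℝ) (x : G) : leftShift h F x = F (h * x) := rfl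

/-- Either there is a left invariant mean on the bounded continuous functions, or some finite
combination of differences of translates is bounded below by `1`. -/
theorem exists_invariant_mean_or :
    (∃ M : (G →ᵇ ℝ) →ₗ[ℝ] ℝ, M 1 = 1 ∧ (∀ F, 0 ≤ F → 0 ≤ M F) ∧ ∀ h F, M (leftShift h F) = M F) ∨
    ∃ (n : ℕ) (h : Fin n → G) (F : Fin n → G →ᵇ ℝ), ∀ x, 1 ≤ ∑ j, (F j x - F j (h j * x)) := by
  by_cases hF : ∃ (n : ℕ) (h : Fin n → G) (F : Fin n → G →ᵇ ℝ),
      ∀ x, 1 ≤ ∑ j, (F j x - F j (h j * x))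
  · exact Or.inr hF
  left
  let N : Submodule ℝ (G →ᵇ ℝ) :=
    Submodule.span ℝ (Set.range fun p : G × (G →ᵇ ℝ) => p.2 - leftShift p.1 p.2)
  have hN : ∀ n ∈ N, ¬ ∀ x, 1 ≤ n x := by
    intro n hn h1
    obtain ⟨d, c, p, rfl⟩ := Submodule.mem_span_set'.1 hn
    choose p' hp' using fun i => (p i).2
    refine hF ⟨d, fun i => (p' i).1, fun i => c i • (p' i).2, fun x => (h1 x).trans (le_of_eq ?_)⟩
    rw [BoundedContinuousFunction.sum_apply]
    refine Finset.sum_congr rfl fun i _ => ?_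
    rw [← hp' i]
    simp [leftShift_apply, mul_sub]
  -- The cone contains the subspace `N` as well as the nonnegative functions, so a functional
  -- nonnegative on it is positive and vanishes on `N`, hence is invariant.
  let s : PointedCone ℝ (G →ᵇ ℝ) :=
    { carrier := {F | ∃ n ∈ N, 0 ≤ F + n}
      add_mem' := by
        rintro F F' ⟨n, hn, h⟩ ⟨n', hn', h'⟩
        exact ⟨n + n', N.add_mem hn hn', by rw [add_add_add_comm]; exact add_nonneg h h'⟩
      zero_mem' := ⟨0, N.zero_mem, by simp⟩
      smul_mem' := by
        rintro c F ⟨n, hn, h⟩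
        refine ⟨(c : ℝ) • n, N.smul_mem _ hn, fun x => ?_⟩
        have h1 : 0 ≤ F x + n x := h x
        have h2 := mul_nonneg c.2 h1
        rw [mul_add] at h2
        exact h2 }
  have hs : ∀ F, F ∈ s ↔ ∃ n ∈ N, 0 ≤ F + n := fun F => Iff.rfl
  have h10 : (1 : G →ᵇ ℝ) ≠ 0 := fun h => by
    have := congrArg (fun F : G →ᵇ ℝ => F 1) h
    simp at this
  obtain ⟨M, hM, hMs⟩ := riesz_extension s (LinearPMap.mkSpanSingleton (1 : G →ᵇ ℝ) (1 : ℝ) h10)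
    (by
      rintro ⟨x, hx⟩ hxs
      obtain ⟨c, rfl⟩ := Submodule.mem_span_singleton.1 hx
      rw [LinearPMap.mkSpanSingleton'_apply, RingHom.id_apply, smul_eq_mul, mul_one]
      by_contra! hc
      obtain ⟨n, hn, h⟩ := (hs _).1 hxs
      -- If a negative constant lay in the cone, some element of `N` would be bounded below by a
      -- positive constant; rescaling makes that constant `1`.
      refine hN ((-c)⁻¹ • n) (N.smul_mem _ hn) fun x => ?_
      have h1 : 0 ≤ c + n x := by simpa using h x
      have h2 : 1 ≤ (-c)⁻¹ * n x := by
        rw [← div_eq_inv_mul, le_div_iff₀ (by linarith)]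
        linarith
      simpa using h2)
    (fun y => ⟨⟨‖y‖ • 1, Submodule.smul_mem _ _ (Submodule.mem_span_singleton_self _)⟩, 0,
      N.zero_mem, fun x => by
        have := (abs_le.1 (y.norm_coe_le_norm x)).1
        change 0 ≤ ‖y‖ * 1 + y x + 0
        linarith⟩)
  refine ⟨M, ?_, fun F hF => hMs F ⟨0, N.zero_mem, by simpa using hF⟩, fun h F => ?_⟩
  · have := hM ⟨1, Submodule.mem_span_singleton_self _⟩
    rw [this]
    exact LinearPMap.mkSpanSingleton_apply ℝ ℝ h10 _
  · have hmem : F - leftShift h F ∈ N := Submodule.subset_span ⟨(h, F), rfl⟩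
    have h1 : 0 ≤ M (F - leftShift h F) := hMs _ ⟨-(F - leftShift h F), N.neg_mem hmem, by simp⟩
    have h2 : 0 ≤ M (-(F - leftShift h F)) := hMs _ ⟨F - leftShift h F, hmem, by simp⟩
    rw [map_neg] at h2
    rw [map_sub] at h1 h2
    linarith

/-- A finite combination of differences of translates which is bounded below by `1` gives a Markov
transition on `G` under which a function comparable to `1` is contracted. -/
theorem exists_contracting_flow {n : ℕ} (h : Fin n → G) (F : Fin n → G →ᵇ ℝ)
    (hF : ∀ x, 1 ≤ ∑ j, (F j x - F j (h j * x))) :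
    ∃ (q : Fin n → G →ᵇ ℝ) (v : G → ℝ) (V θ : ℝ), (∀ j x, 0 ≤ q j x) ∧ (∀ x, ∑ j, q j x = 1) ∧
      (∀ x, 1 ≤ v x) ∧ (∀ x, v x ≤ V) ∧ 0 ≤ θ ∧ θ < 1 ∧
      ∀ x, ∑ j, q j (h j * x) * v (h j * x) ≤ θ * v x := by
  -- Adding constants makes the functions nonnegative without changing the differences of
  -- translates.
  set P : Fin n → G →ᵇ ℝ := fun j => F j + BoundedContinuousFunction.const G ‖F j‖ with hP
  have hPapp : ∀ j x, P j x = F j x + ‖F j‖ := fun j x => rfl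
  have hP0 : ∀ j x, 0 ≤ P j x := by
    intro j x
    have := (abs_le.1 ((F j).norm_coe_le_norm x)).1
    rw [hPapp]
    linarith
  set v : G →ᵇ ℝ := ∑ j, P j with hv
  have hvapp : ∀ x, v x = ∑ j, P j x := fun x => by rw [hv, BoundedContinuousFunction.sum_apply]
  have hvin : ∀ x, 1 + ∑ j, P j (h j * x) ≤ v x := by
    intro x
    have h1 := hF x
    have h2 : ∑ j, (F j x - F j (h j * x)) = ∑ j, P j x - ∑ j, P j (h j * x) := by
      rw [← Finset.sum_sub_distrib]
      exact Finset.sum_congr rfl fun j _ => by rw [hPapp, hPapp]; ring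
    rw [hvapp]
    linarith
  have hv1 : ∀ x, 1 ≤ v x := fun x => by
    have h1 := hvin x
    have h2 : 0 ≤ ∑ j, P j (h j * x) := Finset.sum_nonneg fun j _ => hP0 _ _
    linarith
  have hv0 : ∀ x, 0 < v x := fun x => one_pos.trans_le (hv1 x)
  have hvV : ∀ x, v x ≤ ‖v‖ := fun x => (le_abs_self _).trans (v.norm_coe_le_norm x)
  have hV1 : 1 ≤ ‖v‖ := (hv1 1).trans (hvV 1)
  have hPv : ∀ j x, P j x ≤ v x := fun j x => by
    rw [hvapp]
    exact Finset.single_le_sum (f := fun j => P j x) (fun i _ => hP0 i x) (Finset.mem_univ j)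
  have hqb : ∀ j x, ‖P j x / v x‖ ≤ 1 := fun j x => by
    rw [Real.norm_of_nonneg (div_nonneg (hP0 j x) (hv0 x).le)]
    exact (div_le_one (hv0 x)).2 (hPv j x)
  -- With `q j = P j / v` the incoming mass at `x` is `∑ P j (h j * x) ≤ v x - 1`, and `1 ≥ v x /
  -- ‖v‖` gives `θ = 1 - ‖v‖⁻¹`.
  refine ⟨fun j => BoundedContinuousFunction.ofNormedAddCommGroup (fun x => P j x / v x)
    ((P j).continuous.div v.continuous fun x => (hv0 x).ne') 1 (hqb j), v, ‖v‖, 1 - ‖v‖⁻¹,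
    fun j x => div_nonneg (hP0 j x) (hv0 x).le, fun x => ?_, hv1, hvV, ?_, ?_, fun x => ?_⟩
  · change ∑ j, P j x / v x = 1
    rw [← Finset.sum_div, ← hvapp, div_self (hv0 x).ne']
  · have := inv_le_one_of_one_le₀ hV1
    linarith
  · have : 0 < ‖v‖⁻¹ := inv_pos.2 (one_pos.trans_le hV1)
    linarith
  · change ∑ j, P j (h j * x) / v (h j * x) * v (h j * x) ≤ _
    have h1 : ∑ j, P j (h j * x) / v (h j * x) * v (h j * x) = ∑ j, P j (h j * x) :=
      Finset.sum_congr rfl fun j _ => div_mul_cancel₀ _ (hv0 _).ne'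
    have h2 : ‖v‖⁻¹ * v x ≤ 1 := by
      rw [inv_mul_le_iff₀ (one_pos.trans_le hV1), mul_one]
      exact hvV x
    have h3 := hvin x
    rw [h1]
    linarith

/-- A homomorphism to the reals which is locally bounded above at the identity is continuous. -/
theorem continuous_of_map_mul_of_le {ψ : G → ℝ} (hψ : ∀ g h, ψ (g * h) = ψ g + ψ h) {u : G → ℝ}
    (hu : Continuous u) (hle : ∀ g, ψ g ≤ u g) : Continuous ψ := by
  have hone : ψ 1 = 0 := by
    have := hψ 1 1
    rw [mul_one] at this
    linarith
  have hinv : ∀ g, ψ g⁻¹ = - ψ g := fun g => by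
    have := hψ g g⁻¹
    rw [mul_inv_cancel, hone] at this
    linarith
  have hpow : ∀ g (n : ℕ), ψ (g ^ n) = n * ψ g := by
    intro g n
    induction n with
    | zero => simp [hone]
    | succ n ih => rw [pow_succ, hψ, ih]; push_cast; ring
  have hu1 : 0 ≤ u 1 := by rw [← hone]; exact hle 1
  have hsmall : ∀ ε > 0, ∀ᶠ z in 𝓝 (1 : G), |ψ z| < ε := by
    intro ε hε
    -- Near `1`, `n ψ(z) = ψ(z^n)` is below `u 1 + 1`, and likewise for the inverse of `z`; this `n`
    -- forces `|ψ z| < ε`.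
    obtain ⟨n, hn⟩ := exists_nat_gt ((u 1 + 1) / ε)
    have hn0 : (0 : ℝ) < n := lt_of_le_of_lt (by positivity) hn
    have e1 : ∀ᶠ z in 𝓝 (1 : G), u (z ^ n) < u 1 + 1 := by
      have : Tendsto (fun z : G => u (z ^ n)) (𝓝 1) (𝓝 (u (1 ^ n))) :=
        (hu.comp (continuous_pow n)).tendsto 1
      rw [one_pow] at this
      exact this.eventually (gt_mem_nhds (by linarith))
    have e2 : ∀ᶠ z in 𝓝 (1 : G), u (z⁻¹ ^ n) < u 1 + 1 := by
      have : Tendsto (fun z : G => u (z⁻¹ ^ n)) (𝓝 1) (𝓝 (u (1⁻¹ ^ n))) :=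
        (hu.comp ((continuous_pow n).comp continuous_inv)).tendsto 1
      rw [inv_one, one_pow] at this
      exact this.eventually (gt_mem_nhds (by linarith))
    filter_upwards [e1, e2] with z h1 h2
    have h3 := (hle _).trans_lt h1
    have h4 := (hle _).trans_lt h2
    rw [hpow] at h3 h4
    rw [hinv] at h4
    rw [div_lt_iff₀ hε] at hn
    rw [abs_lt]
    constructor <;> nlinarith
  rw [continuous_iff_continuousAt]
  intro y
  rw [ContinuousAt, Metric.tendsto_nhds]
  intro ε hε
  have hy : Tendsto (fun x => y⁻¹ * x) (𝓝 y) (𝓝 1) := by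
    have := (continuous_const_mul y⁻¹).tendsto y
    rwa [inv_mul_cancel] at this
  filter_upwards [hy.eventually (hsmall ε hε)] with x hx
  rw [hψ, hinv] at hx
  rw [Real.dist_eq]
  convert hx using 2
  ring

/-- In the presence of a left invariant mean every weight dominates a positive character. -/
theorem GroupWeight.exists_character_le (ω : GroupWeight G) {M : (G →ᵇ ℝ) →ₗ[ℝ] ℝ} (hM1 : M 1 = 1)
    (hM0 : ∀ F, 0 ≤ F → 0 ≤ M F) (hMinv : ∀ h F, M (leftShift h F) = M F) :
    ∃ φ : G →* ℝ, Continuous φ ∧ (∀ g, 0 < φ g) ∧ ∀ g, φ g ≤ ω g := by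
  have hlogc : Continuous fun x => Real.log (ω x) :=
    ω.continuous_toFun.log fun x => (ω.pos x).ne'
  have hlog : ∀ g x, Real.log (ω (g * x)) ≤ Real.log (ω g) + Real.log (ω x) := fun g x => by
    rw [← Real.log_mul (ω.pos g).ne' (ω.pos x).ne']
    exact Real.log_le_log (ω.pos _) (ω.mul_le g x)
  have hupper : ∀ g x, Real.log (ω (g * x)) - Real.log (ω x) ≤ Real.log (ω g) := fun g x => by
    have := hlog g x
    linarith
  have hlower : ∀ g x, -Real.log (ω g⁻¹) ≤ Real.log (ω (g * x)) - Real.log (ω x) := fun g x => by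
    have := hlog g⁻¹ (g * x)
    rw [inv_mul_cancel_left] at this
    linarith
  let D : G → (G →ᵇ ℝ) := fun g => BoundedContinuousFunction.ofNormedAddCommGroup
    (fun x => Real.log (ω (g * x)) - Real.log (ω x))
    ((hlogc.comp (continuous_const_mul g)).sub hlogc)
    (max |Real.log (ω g⁻¹)| |Real.log (ω g)|) (fun x => by
      have h1 := hupper g x
      have h2 := hlower g x
      have h3 := le_abs_self (Real.log (ω g⁻¹))
      have h4 := le_abs_self (Real.log (ω g))
      rw [Real.norm_eq_abs, abs_le]
      exact ⟨by linarith [le_max_left |Real.log (ω g⁻¹)| |Real.log (ω g)|],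
        by linarith [le_max_right |Real.log (ω g⁻¹)| |Real.log (ω g)|]⟩)
  have hD : ∀ g x, D g x = Real.log (ω (g * x)) - Real.log (ω x) := fun g x => rfl
  have hadd : ∀ g h, M (D (g * h)) = M (D g) + M (D h) := by
    intro g h
    -- The cocycle identity, which invariance of `M` turns into additivity.
    have : D (g * h) = leftShift h (D g) + D h := by
      ext x
      rw [BoundedContinuousFunction.add_apply, leftShift_apply, hD, hD, hD, mul_assoc]
      ring
    rw [this, map_add, hMinv]
  have hle : ∀ g, M (D g) ≤ Real.log (ω g) := by
    intro g
    have h1 : 0 ≤ M (Real.log (ω g) • 1 - D g) := hM0 _ fun x => by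
      have := hupper g x
      simpa [hD] using this
    rw [map_sub, map_smul, hM1, smul_eq_mul, mul_one] at h1
    linarith
  have hcont : Continuous fun g => M (D g) := continuous_of_map_mul_of_le hadd hlogc hle
  refine ⟨⟨⟨fun g => Real.exp (M (D g)), ?_⟩, fun g h => ?_⟩, Real.continuous_exp.comp hcont,
    fun g => Real.exp_pos _, fun g => ?_⟩
  · have := hadd 1 1
    rw [mul_one] at this
    rw [Real.exp_eq_one_iff]
    linarith
  · change Real.exp (M (D (g * h))) = Real.exp (M (D g)) * Real.exp (M (D h))
    rw [hadd, Real.exp_add]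
  · calc Real.exp (M (D g)) ≤ Real.exp (Real.log (ω g)) := Real.exp_le_exp.2 (hle g)
      _ = ω g := Real.exp_log (ω.pos g)

end InvariantMean

theorem proposition3p3 {G : Type*} [Group G] [TopologicalSpace G] [IsTopologicalGroup G]
    [LocallyCompactSpace G] [T2Space G] [MeasurableSpace G] [BorelSpace G]
    (μ : Measure G) [μ.IsHaarMeasure] [μ.Regular] (ω : GroupWeight G)
    (h : PseudoAmenable (BeurlingAlgebra μ ω)) :
    ∃ φ : G →* ℝ, Continuous φ ∧ (∀ g, 0 < φ g) ∧ ∀ g, φ g ≤ ω g := by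
  rcases exists_invariant_mean_or (G := G) with ⟨M, hM1, hM0, hMinv⟩ | ⟨n, s, F, hF⟩
  · exact ω.exists_character_le hM1 hM0 hMinv
  · obtain ⟨q, v, V, θ, hq, hq1, hv, hvV, hθ0, hθ1, hflow⟩ := exists_contracting_flow s F hF
    -- Mass arrives at `x` from `(t j)⁻¹ * x`, so the transition moves by the inverses of the `s j`.
    exact absurd h (BeurlingAlgebra.not_pseudoAmenable_of_flow (fun j => (s j)⁻¹) q hq hq1 hv hvV
      hθ0 hθ1 (by simpa only [inv_inv] using hflow))
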